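/- Let $n\ge 1$. Write $a_+=\max(a,0)$, $\Gamma=\partial[0,1]^n\setminus(0,1]^n$, and for $h>0$ and $\Omega\subset\mathbb R^n$ put $\Omega_h=\Omega\cap(h\mathbb Z)^n$ and $D_i^-v(x)=\frac{v(x)-v(x-he_i)}{h}$. For $f:[0,1]^n\to(0,\infty)$ consider: (P1) $\ \prod_{i=1}^n(u_{x_i})_+=f$ in $(0,1]^n$, $\ u=0$ on $\Gamma$; (S2) $\ \prod_{i=1}^n(D_i^-v_h(x))_+=v_h(x)^{n-1}f(x)$ for $x\in(0,1]^n_h$, $\ v_h=0$ on $\Gamma_h$. A viscosity subsolution of (P1) is an upper semicontinuous $u:[0,1]^n\to\mathbb R$ with $u\le 0$ on $\Gamma$ such that $\prod_i(\varphi_{x_i}(x_0))_+\le f(x_0)$ whenever $\varphi\in C^1(\mathbb R^n)$ and $u-\varphi$ has a local maximum at $x_0\in(0,1]^n$ relative to $(0,1]^n$. A viscosity supersolution is defined with lower semicontinuity, $u\ge 0$ on $\Gamma$, local minima and $\ge$. A viscosity solution is both; it is nondecreasing if $u$ is nondecreasing in each coordinate. The maximal solution $v_h:[0,1]^n_h\to\mathbb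 R$ of (S2) is the one for which, at each $x\in(0,1]^n_h$ and given the values $v_h(x-he_i)$, $v_h(x)$ is the largest $t\in\mathbb R$ with $\prod_i\big(\frac{t-v_h(x-he_i)}{h}\big)_+=t^{n-1}f(x)$ (with $t^0=1$ if $n=1$). **Theorem.** For all $n\ge1$, $L\ge0$ and $m>0$ there is a constant $C=C(n,L,m)>0$ such that the following holds. Let $f:[0,1]^n\to(0,\infty)$ be Lipschitz with constant $L$ in the Euclidean norm and $\inf_{[0,1]^n}f=m$, let $u$ be the nondecreasing viscosity solution of (P1), let $h>0$, and let $v_h$ be the maximal solution of (S2). Then $$|n^nv_h(x)-u(x)^n|\le C\sqrt h\quad\text{for all }x\in[0,1]^n_h,$$ and, for every $\delta>0$, $$|n\,v_h(x)^{1/n}-u(x)|\le C\,\delta^{1-n}\sqrt h\quad\text{for all }x\in[\delta,1]^n_h.$$ -/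

import Mathlib

open scoped NNReal

namespace HJ

/-- `[0,1]^n` as a subset of Euclidean space. -/
def cube (n : ℕ) : Set (EuclideanSpace ℝ (Fin n)) :=
  {x | ∀ i, x i ∈ Set.Icc (0 : ℝ) 1}

/-- `(0,1]^n`. -/
def halfOpenCube (n : ℕ) : Set (EuclideanSpace ℝ (Fin n)) :=
  {x | ∀ i, x i ∈ Set.Ioc (0 : ℝ) 1}

/-- `[δ,1]^n`. -/
def subcube (n : ℕ) (δ : ℝ) : Set (EuclideanSpace ℝ (Fin n)) :=
  {x | ∀ i, x i ∈ Set.Icc δ 1}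

/-- `Γ = ∂[0,1]^n \ (0,1]^n`, the part of the boundary carrying the boundary condition. -/
def Gam (n : ℕ) : Set (EuclideanSpace ℝ (Fin n)) :=
  frontier (cube n) \ halfOpenCube n

/-- The grid `ℤ_h^n = (hℤ)^n`. For a set `Ω` one has `Ω_h = Ω ∩ grid n h`. -/
def grid (n : ℕ) (h : ℝ) : Set (EuclideanSpace ℝ (Fin n)) :=
  {x | ∀ i, ∃ k : ℤ, x i = h * k}

/-- The partial derivative `∂φ/∂x_i` at `x`. -/
noncomputable def partialDeriv {n : ℕ} (φ : EuclideanSpace ℝ (Fin n) → ℝ) (i : Fin n)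
    (x : EuclideanSpace ℝ (Fin n)) : ℝ :=
  fderiv ℝ φ x (EuclideanSpace.single i 1)

/-- `u` is a viscosity subsolution of `∏ (u_{x_i})_+ = f` in `(0,1]^n`, `u = 0` on `Γ`:
it is upper semicontinuous on `[0,1]^n`, at most `0` on `Γ`, and at every local maximum of `u - φ`
relative to `(0,1]^n`, with `φ` of class `C¹`, one has `∏ (φ_{x_i})_+ ≤ f`. -/
def IsViscositySubsolution {n : ℕ} (f u : EuclideanSpace ℝ (Fin n) → ℝ) : Prop :=
  UpperSemicontinuousOn u (cube n) ∧
  (∀ x ∈ Gam n, u x ≤ 0) ∧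
  ∀ φ : EuclideanSpace ℝ (Fin n) → ℝ, ContDiff ℝ 1 φ →
    ∀ x ∈ halfOpenCube n, IsLocalMaxOn (fun y => u y - φ y) (halfOpenCube n) x →
      ∏ i, max (partialDeriv φ i x) 0 ≤ f x

/-- `u` is a viscosity supersolution of `∏ (u_{x_i})_+ = f` in `(0,1]^n`, `u = 0` on `Γ`. -/
def IsViscositySupersolution {n : ℕ} (f u : EuclideanSpace ℝ (Fin n) → ℝ) : Prop :=
  LowerSemicontinuousOn u (cube n) ∧
  (∀ x ∈ Gam n, 0 ≤ u x) ∧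
  ∀ φ : EuclideanSpace ℝ (Fin n) → ℝ, ContDiff ℝ 1 φ →
    ∀ x ∈ halfOpenCube n, IsLocalMinOn (fun y => u y - φ y) (halfOpenCube n) x →
      f x ≤ ∏ i, max (partialDeriv φ i x) 0

/-- `u` is a viscosity solution (both a sub- and a supersolution; in particular it is continuous
on `[0,1]^n` and vanishes on `Γ`). -/
def IsViscositySolution {n : ℕ} (f u : EuclideanSpace ℝ (Fin n) → ℝ) : Prop :=
  IsViscositySubsolution f u ∧ IsViscositySupersolution f u

/-- `u` is nondecreasing in each coordinate on `[0,1]^n`. -/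
def IsNondecreasing {n : ℕ} (u : EuclideanSpace ℝ (Fin n) → ℝ) : Prop :=
  ∀ x ∈ cube n, ∀ y ∈ cube n, (∀ i, x i ≤ y i) → u x ≤ u y

/-- `v` (of which only the values on `[0,1]^n_h` matter) is the maximal solution of
`∏ (D_i^- v(x))_+ = v(x)^(n-1) f(x)` on `(0,1]^n_h`, `v = 0` on `Γ_h`: at each grid point `x` of
`(0,1]^n`, given the values `v (x - h e_i)`, the number `v x` is the largest real solution `t` of
`∏ ((t - v (x - h e_i)) / h)_+ = t^(n-1) f(x)`. -/
def IsMaximalSchemeSolution {n : ℕ} (h : ℝ) (f v : EuclideanSpace ℝ (Fin n) → ℝ) : Prop :=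
  (∀ x ∈ Gam n ∩ grid n h, v x = 0) ∧
  ∀ x ∈ halfOpenCube n ∩ grid n h,
    IsGreatest
      {t : ℝ | ∏ i, max ((t - v (x - EuclideanSpace.single i h)) / h) 0 = t ^ (n - 1) * f x}
      (v x)

end HJ

/-!
With `w = (u/n)^n` the equation `∏ u_{x_i} = f` becomes `∏ w_{x_i} = w^(n-1) f`, which is the equation
discretized by the scheme. It is not monotone in `w`, and relative errors are uncontrolled near the
faces `x_i = 0` unless the behaviour of `w` there is factored out. Both difficulties disappear for the
quotient `Z = w / ∏ x_i`, which solves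

  `Z ∏ (1 + x_i (log Z)_{x_i}) = f`.

This equation is proper in `log Z`, and it degenerates on the faces, so that no boundary
condition is needed for a comparison argument. The scheme has the same structure: `z = v / ∏ y_i`
solves `z ∏ (1 + (y_i - h) D_i^- z / z) = f` (`IsQuotientSolution`,
`IsMaximalSchemeSolution.isQuotientSolution`).

The discrete quotient lies between `inf f` and `sup f` (`IsQuotientSolution.ge`,
`IsQuotientSolution.le`). Comparing `z` with its translate at a maximum point of their ratio shows that
`log z` is Lipschitz with constant `K = L / m` up to the faces (`IsQuotientSolution.le_mul_back`,
`IsQuotientSolution.back_le_mul`).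

The two quotients are compared by doubling variables in ratio form, with penalization
`exp (-|x - y|² / (2 √h))`. At a maximum point the Lipschitz bound for `log z` gives
`|x_i - y_i| ≤ (K + 1) √h` (`abs_sub_le_of_isMax`), and the viscosity inequality and the scheme, whose
products of first-order factors agree up to an error `O(√h)` of the needed sign, give
`Z / z ≤ 1 + C √h` and, with the roles exchanged, `z / Z ≤ 1 + C √h`
(`shiftQuotient_le_quotientSolution`, `quotientSolution_le_shiftQuotient`). To keep the maximum point in
`(0,1]^n`, the faces are moved to `x_i = ∓σ`, and `σ → 0` at the end. So the
error is of relative order `√h`, up to the faces (`relative_error`); both estimates of the theorem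
follow, the second one with `v ≥ m ∏ y_i`.
-/

namespace HJ

open Filter Topology

variable {n : ℕ} {h : ℝ} {f z u : EuclideanSpace ℝ (Fin n) → ℝ}

/-! ### The grid -/

/-- The grid points of `(0,1]^n`, where the scheme is imposed. -/
def posGrid (n : ℕ) (h : ℝ) : Set (EuclideanSpace ℝ (Fin n)) :=
  halfOpenCube n ∩ grid n h

/-- The backward neighbour `y - h e_i` of `y`. -/
noncomputable def back (h : ℝ) (i : Fin n) (y : EuclideanSpace ℝ (Fin n)) :
    EuclideanSpace ℝ (Fin n) :=
  y - EuclideanSpace.single i h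

lemma back_apply (h : ℝ) (i j : Fin n) (y : EuclideanSpace ℝ (Fin n)) :
    back h i y j = y j - if j = i then h else 0 := by
  simp [back, PiLp.single_apply]

lemma back_self (h : ℝ) (i : Fin n) (y : EuclideanSpace ℝ (Fin n)) :
    back h i y i = y i - h := by
  simp [back_apply]

lemma back_of_ne (h : ℝ) {i j : Fin n} (hij : j ≠ i) (y : EuclideanSpace ℝ (Fin n)) :
    back h i y j = y j := by
  simp [back_apply, hij]

lemma back_comm (h : ℝ) (i k : Fin n) (y : EuclideanSpace ℝ (Fin n)) :
    back h i (back h k y) = back h k (back h i y) := by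
  simp only [back]; abel

lemma halfOpenCube_subset_cube : halfOpenCube n ⊆ cube n :=
  fun _ hx i => ⟨(hx i).1.le, (hx i).2⟩

lemma posGrid_subset_halfOpenCube : posGrid n h ⊆ halfOpenCube n := Set.inter_subset_left

lemma posGrid_subset_cube : posGrid n h ⊆ cube n :=
  posGrid_subset_halfOpenCube.trans halfOpenCube_subset_cube

lemma le_apply_of_mem_posGrid (hh : 0 < h) {y : EuclideanSpace ℝ (Fin n)}
    (hy : y ∈ posGrid n h) (i : Fin n) : h ≤ y i := by
  obtain ⟨k, hk⟩ := hy.2 i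
  have h0 := (hy.1 i).1
  rw [hk] at h0 ⊢
  have hk1 : (0 : ℝ) < k := (mul_pos_iff_of_pos_left hh).1 h0
  have hk2 : (1 : ℝ) ≤ k := by exact_mod_cast hk1
  nlinarith

lemma back_mem_grid {y : EuclideanSpace ℝ (Fin n)} (hy : y ∈ grid n h) (i : Fin n) :
    back h i y ∈ grid n h := by
  intro j
  obtain ⟨k, hk⟩ := hy j
  by_cases hj : j = i
  · refine ⟨k - 1, ?_⟩
    subst hj
    rw [back_self, hk]; push_cast; ring
  · exact ⟨k, by rw [back_of_ne h hj, hk]⟩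

lemma back_mem_posGrid (hh : 0 < h) {y : EuclideanSpace ℝ (Fin n)} (hy : y ∈ posGrid n h)
    {i : Fin n} (hi : h < y i) : back h i y ∈ posGrid n h := by
  refine ⟨fun j => ?_, back_mem_grid hy.2 i⟩
  have hj := hy.1 j
  by_cases hji : j = i
  · subst hji
    rw [back_self]
    exact ⟨by linarith, by linarith [hj.2]⟩
  · rw [back_of_ne h hji]; exact hj

lemma eq_or_back_mem_posGrid (hh : 0 < h) {y : EuclideanSpace ℝ (Fin n)} (hy : y ∈ posGrid n h)
    (i : Fin n) : y i = h ∨ back h i y ∈ posGrid n h := by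
  rcases (le_apply_of_mem_posGrid hh hy i).eq_or_lt with e | e
  · exact Or.inl e.symm
  · exact Or.inr (back_mem_posGrid hh hy e)

lemma lt_apply_of_back_mem_posGrid {y : EuclideanSpace ℝ (Fin n)}
    {i : Fin n} (hb : back h i y ∈ posGrid n h) : h < y i := by
  have := (hb.1 i).1
  rw [back_self] at this
  linarith

/-- The forward neighbour of a grid point, written as the point whose backward neighbour it is. -/
lemma exists_forward (hh : 0 < h) {y : EuclideanSpace ℝ (Fin n)} (hy : y ∈ posGrid n h)
    (i : Fin n) (hi : y i + h ≤ 1) : ∃ y' ∈ posGrid n h, back h i y' = y := by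
  refine ⟨y + EuclideanSpace.single i h, ⟨fun j => ?_, fun j => ?_⟩, ?_⟩
  · have hj := hy.1 j
    by_cases hji : j = i
    · subst hji
      simp only [PiLp.add_apply, PiLp.single_apply, if_true]
      exact ⟨by linarith [hj.1], hi⟩
    · simpa [PiLp.single_apply, hji] using hj
  · obtain ⟨k, hk⟩ := hy.2 j
    by_cases hji : j = i
    · subst hji
      refine ⟨k + 1, ?_⟩
      simp only [PiLp.add_apply, PiLp.single_apply, if_true, hk]
      push_cast; ring
    · exact ⟨k, by simp [hji, hk]⟩
  · simp [back]

lemma posGrid_finite (hh : 0 < h) : (posGrid n h).Finite := by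
  have hfin : (Set.univ.pi fun _ : Fin n => Set.Icc (0 : ℤ) ⌈1 / h⌉).Finite :=
    Set.Finite.pi fun _ => Set.finite_Icc _ _
  refine (hfin.image fun k : Fin n → ℤ =>
    (WithLp.toLp 2 fun i => h * k i : EuclideanSpace ℝ (Fin n))).subset ?_
  intro y hy
  choose k hk using hy.2
  refine ⟨k, fun i _ => ⟨?_, ?_⟩, ?_⟩
  · have h0 := (hy.1 i).1
    rw [hk i] at h0
    exact_mod_cast ((mul_pos_iff_of_pos_left hh).1 h0).le
  · have h1 := (hy.1 i).2
    rw [hk i] at h1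
    have : (k i : ℝ) ≤ 1 / h := by rw [le_div_iff₀ hh]; linarith
    exact_mod_cast this.trans (Int.le_ceil _)
  · ext i; simp [hk i]

lemma mem_Gam_of_notMem_halfOpenCube {x : EuclideanSpace ℝ (Fin n)} (hx : x ∈ cube n)
    (hx' : x ∉ halfOpenCube n) : x ∈ Gam n := by
  refine ⟨⟨subset_closure hx, fun hint => hx' fun i => ?_⟩, hx'⟩
  refine ⟨lt_of_le_of_ne (hx i).1 fun h0 => ?_, (hx i).2⟩
  have hcont : Continuous fun t : ℝ => x - EuclideanSpace.single i t := by
    have : (fun t : ℝ => x - EuclideanSpace.single i t)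
        = fun t : ℝ => x - t • EuclideanSpace.single i (1 : ℝ) := by
      funext t; congr 1; ext j; simp [PiLp.single_apply]
    rw [this]; fun_prop
  have hev : ∀ᶠ t in 𝓝 (0 : ℝ), x - EuclideanSpace.single i t ∈ interior (cube n) := by
    refine hcont.continuousAt.eventually_mem ?_
    have h0' : x - EuclideanSpace.single i (0 : ℝ) = x := by ext j; simp [PiLp.single_apply]
    rw [h0']
    exact isOpen_interior.mem_nhds hint
  have hev' : ∀ᶠ t in 𝓝[>] (0 : ℝ), x - EuclideanSpace.single i t ∈ interior (cube n) :=
    hev.filter_mono nhdsWithin_le_nhds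
  obtain ⟨t, ht, ht0⟩ := (hev'.and self_mem_nhdsWithin).exists
  have := (interior_subset ht i).1
  simp only [PiLp.sub_apply, PiLp.single_apply, if_true, ← h0] at this
  have ht0' : 0 < t := ht0
  linarith

/-! ### The scheme for the quotient by the product of the coordinates -/

/-- The factor `1 + (y_i - h) D_i^- z (y) / z y`. At `y_i = h` it equals `1` whatever the value of
`z` at the backward neighbour, so that no boundary condition is needed. -/
noncomputable def schemeFactor (h : ℝ) (z : EuclideanSpace ℝ (Fin n) → ℝ) (i : Fin n)
    (y : EuclideanSpace ℝ (Fin n)) : ℝ :=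
  1 + (y i / h - 1) * (1 - z (back h i y) / z y)

/-- `z` is a positive solution on `(0,1]^n_h` of `z ∏ (1 + (y_i - h) D_i^- z / z) = f`, the scheme
satisfied by `z = v / ∏ y_i` when `v` solves `∏ D_i^- v = v^(n-1) f`. -/
def IsQuotientSolution (h : ℝ) (f z : EuclideanSpace ℝ (Fin n) → ℝ) : Prop :=
  ∀ y ∈ posGrid n h, 0 < z y ∧ (∀ i, 0 < schemeFactor h z i y) ∧
    z y * ∏ i, schemeFactor h z i y = f y

/-- The largest root of `∏ ((t - a_i) / h)_+ = t^(n-1) c` lies above all the `a_i`. -/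
lemma lt_of_isGreatest_root (hn : n ≠ 0) (hh : 0 < h) {a : Fin n → ℝ} (ha : ∀ i, 0 ≤ a i)
    {c t : ℝ} (hc : 0 < c)
    (ht : IsGreatest {t : ℝ | ∏ i, max ((t - a i) / h) 0 = t ^ (n - 1) * c} t) (i : Fin n) :
    a i < t := by
  have : Nonempty (Fin n) := ⟨i⟩
  obtain ⟨j, hj⟩ := Finite.exists_max a
  refine (hj i).trans_lt ?_
  have hpow : ∀ s : ℝ, s ^ n = s * s ^ (n - 1) := fun s => (mul_pow_sub_one hn s).symm
  rcases (ha j).eq_or_lt with h0 | h0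
  · -- All `a i` vanish, and `h ^ n * c` is a root.
    have hroot : h ^ n * c ∈ {t : ℝ | ∏ i, max ((t - a i) / h) 0 = t ^ (n - 1) * c} := by
      have hz : ∀ i, a i = 0 := fun i => le_antisymm ((hj i).trans h0.ge) (ha i)
      simp only [Set.mem_ofPred_eq, hz, sub_zero]
      rw [max_eq_left (by positivity), Finset.prod_const, Finset.card_univ, Fintype.card_fin,
        div_pow, div_eq_iff (by positivity), hpow (h ^ n * c)]
      ring
    rw [← h0]
    exact (by positivity : 0 < h ^ n * c).trans_le (ht.2 hroot)
  · -- Intermediate value theorem between `a j` and a point where the product dominates.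
    set T : ℝ := 2 * a j + (2 * h) ^ n * c with hT
    have hTpos : 0 < (2 * h) ^ n * c := by positivity
    have hcont : Continuous fun t : ℝ => ∏ i, max ((t - a i) / h) 0 - t ^ (n - 1) * c := by
      fun_prop
    have hle : a j ≤ T := by linarith
    have hlow : ∏ i, max ((a j - a i) / h) 0 - a j ^ (n - 1) * c < 0 := by
      rw [Finset.prod_eq_zero (Finset.mem_univ j) (by simp)]
      have : 0 < a j ^ (n - 1) * c := by positivity
      linarith
    have hhigh : 0 ≤ ∏ i, max ((T - a i) / h) 0 - T ^ (n - 1) * c := by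
      have hfac : ∏ _i : Fin n, T / (2 * h) ≤ ∏ i, max ((T - a i) / h) 0 := by
        refine Finset.prod_le_prod (fun _ _ => by positivity) fun i _ => le_max_of_le_left ?_
        rw [div_le_div_iff₀ (by positivity) hh]
        nlinarith [hj i]
      rw [Finset.prod_const, Finset.card_univ, Fintype.card_fin, div_pow, hpow T] at hfac
      have : T ^ (n - 1) * c ≤ T * T ^ (n - 1) / (2 * h) ^ n := by
        rw [le_div_iff₀ (by positivity)]
        have hp : 0 < T ^ (n - 1) := by positivity
        have : (2 * h) ^ n * c ≤ T := by linarith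
        nlinarith
      linarith
    obtain ⟨s, hs, hs0⟩ := intermediate_value_Icc hle hcont.continuousOn ⟨hlow.le, hhigh⟩
    have hne : a j ≠ s := by
      rintro rfl
      exact hlow.ne hs0
    exact (lt_of_le_of_ne hs.1 hne).trans_le (ht.2 (sub_eq_zero.1 hs0))

section MaximalSolution

variable {v : EuclideanSpace ℝ (Fin n) → ℝ}

lemma IsMaximalSchemeSolution.back_eq_zero (hv : IsMaximalSchemeSolution h f v)
    {y : EuclideanSpace ℝ (Fin n)} (hy : y ∈ posGrid n h) {i : Fin n} (hi : y i = h) :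
    v (back h i y) = 0 := by
  have hb : back h i y i = 0 := by rw [back_self, hi, sub_self]
  refine hv.1 _ ⟨mem_Gam_of_notMem_halfOpenCube (fun j => ?_) fun hmem => ?_,
    back_mem_grid hy.2 i⟩
  · by_cases hji : j = i
    · subst hji
      rw [hb]; simp
    · rw [back_of_ne h hji]
      exact halfOpenCube_subset_cube hy.1 j
  · exact (hmem i).1.ne' hb

lemma IsMaximalSchemeSolution.pos_of_sum_le (hn : n ≠ 0) (hh : 0 < h)
    (hf : ∀ x ∈ cube n, 0 < f x) (hv : IsMaximalSchemeSolution h f v) (N : ℕ) :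
    ∀ y ∈ posGrid n h, ∑ i, y i ≤ N * h → 0 < v y := by
  have i₀ : Fin n := ⟨0, Nat.pos_of_ne_zero hn⟩
  induction N with
  | zero =>
    intro y hy hs
    have : 0 < ∑ i, y i := Finset.sum_pos (fun i _ => (hy.1 i).1) ⟨i₀, Finset.mem_univ _⟩
    simp at hs
    linarith
  | succ N ih =>
    intro y hy hs
    have hback : ∀ i, 0 ≤ v (back h i y) := by
      intro i
      rcases eq_or_back_mem_posGrid hh hy i with hi | hi
      · exact (hv.back_eq_zero hy hi).ge
      · refine (ih _ hi ?_).le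
        simp only [back_apply, Finset.sum_sub_distrib, Finset.sum_ite_eq', Finset.mem_univ,
          if_true]
        push_cast at hs
        linarith
    exact (hback i₀).trans_lt
      (lt_of_isGreatest_root hn hh hback (hf y (posGrid_subset_cube hy)) (hv.2 y hy) i₀)

lemma IsMaximalSchemeSolution.pos (hn : n ≠ 0) (hh : 0 < h)
    (hf : ∀ x ∈ cube n, 0 < f x) (hv : IsMaximalSchemeSolution h f v)
    {y : EuclideanSpace ℝ (Fin n)} (hy : y ∈ posGrid n h) : 0 < v y := by
  obtain ⟨N, hN⟩ := exists_nat_ge ((∑ i, y i) / h)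
  exact hv.pos_of_sum_le hn hh hf N y hy ((div_le_iff₀ hh).1 hN)

/-- Dividing the maximal solution by the product of the coordinates gives a solution of the
quotient scheme. -/
lemma IsMaximalSchemeSolution.isQuotientSolution (hn : n ≠ 0) (hh : 0 < h)
    (hf : ∀ x ∈ cube n, 0 < f x) (hv : IsMaximalSchemeSolution h f v) :
    IsQuotientSolution h f fun y => v y / ∏ i, y i := by
  intro y hy
  have hpos := hv.pos hn hh hf hy
  have hyi : ∀ i, 0 < y i := fun i => (hy.1 i).1
  have hP : 0 < ∏ i, y i := Finset.prod_pos fun i _ => hyi i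
  have hback : ∀ i, 0 ≤ v (back h i y) := by
    intro i
    rcases eq_or_back_mem_posGrid hh hy i with hi | hi
    · exact (hv.back_eq_zero hy hi).ge
    · exact (hv.pos hn hh hf hi).le
  have hlt := lt_of_isGreatest_root hn hh hback (hf y (posGrid_subset_cube hy)) (hv.2 y hy)
  have hfac : ∀ i, schemeFactor h (fun y => v y / ∏ i, y i) i y
      = y i / v y * ((v y - v (back h i y)) / h) := by
    intro i
    rcases eq_or_back_mem_posGrid hh hy i with hi | hi
    · rw [schemeFactor, hv.back_eq_zero hy hi, hi]
      field_simp
      ring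
    · have hPi : ∏ j, back h i y j = (y i - h) * ∏ j ∈ Finset.univ.erase i, y j := by
        rw [← Finset.mul_prod_erase _ _ (Finset.mem_univ i), back_self]
        congr 1
        exact Finset.prod_congr rfl fun j hj => back_of_ne h (Finset.ne_of_mem_erase hj) y
      have hPe : 0 < ∏ j ∈ Finset.univ.erase i, y j := Finset.prod_pos fun i _ => hyi i
      have hhy : 0 < y i - h := by linarith [lt_apply_of_back_mem_posGrid hi]
      rw [schemeFactor, hPi, ← Finset.mul_prod_erase _ _ (Finset.mem_univ i)]
      have := hyi i
      field_simp
      ring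
  refine ⟨by positivity, fun i => ?_, ?_⟩
  · rw [hfac]
    have := hyi i
    have := sub_pos.2 (hlt i)
    positivity
  · have hsol : ∏ i, max ((v y - v (back h i y)) / h) 0 = v y ^ (n - 1) * f y := (hv.2 y hy).1
    have hmax : ∏ i, max ((v y - v (back h i y)) / h) 0 = ∏ i, (v y - v (back h i y)) / h :=
      Finset.prod_congr rfl fun i _ =>
        max_eq_left (div_nonneg (sub_pos.2 (hlt i)).le hh.le)
    rw [hmax] at hsol
    simp only [hfac]
    rw [Finset.prod_mul_distrib, hsol, Finset.prod_div_distrib, Finset.prod_const,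
      Finset.card_univ, Fintype.card_fin, ← mul_pow_sub_one hn (v y)]
    field_simp

end MaximalSolution

section QuotientScheme

variable {m M K : ℝ} {y : EuclideanSpace ℝ (Fin n)}

lemma schemeFactor_coeff_nonneg (hh : 0 < h) (hy : y ∈ posGrid n h) (i : Fin n) :
    0 ≤ y i / h - 1 := by
  rw [sub_nonneg, le_div_iff₀ hh]
  linarith [le_apply_of_mem_posGrid hh hy i]

lemma schemeFactor_of_eq (hh : 0 < h) {i : Fin n} (hi : y i = h) : schemeFactor h z i y = 1 := by
  rw [schemeFactor, hi, div_self hh.ne']; ring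

/-- Discrete maximum principle: the quotient is at most `sup f`. -/
lemma IsQuotientSolution.le (hh : 0 < h) (hz : IsQuotientSolution h f z)
    (hfM : ∀ x ∈ cube n, f x ≤ M) (hy : y ∈ posGrid n h) : z y ≤ M := by
  obtain ⟨y₀, hy₀, hmax⟩ := Set.exists_max_image _ z (posGrid_finite hh) ⟨y, hy⟩
  refine (hmax y hy).trans (le_trans ?_ (hfM y₀ (posGrid_subset_cube hy₀)))
  obtain ⟨hpos, -, heq⟩ := hz y₀ hy₀
  rw [← heq]
  refine le_mul_of_one_le_right hpos.le ?_
  rw [← Finset.prod_const_one (s := (Finset.univ : Finset (Fin n)))]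
  refine Finset.prod_le_prod (fun _ _ => zero_le_one) fun i _ => ?_
  rcases eq_or_back_mem_posGrid hh hy₀ i with hi | hi
  · exact (schemeFactor_of_eq hh hi).ge
  · refine le_add_of_nonneg_right (mul_nonneg (schemeFactor_coeff_nonneg hh hy₀ i) ?_)
    rw [sub_nonneg, div_le_one hpos]
    exact hmax _ hi

/-- Discrete minimum principle: the quotient is at least `inf f`. -/
lemma IsQuotientSolution.ge (hh : 0 < h) (hz : IsQuotientSolution h f z)
    (hfm : ∀ x ∈ cube n, m ≤ f x) (hy : y ∈ posGrid n h) : m ≤ z y := by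
  obtain ⟨y₀, hy₀, hmin⟩ := Set.exists_min_image _ z (posGrid_finite hh) ⟨y, hy⟩
  refine le_trans (le_trans (hfm y₀ (posGrid_subset_cube hy₀)) ?_) (hmin y hy)
  obtain ⟨hpos, hF, heq⟩ := hz y₀ hy₀
  rw [← heq]
  refine mul_le_of_le_one_right hpos.le (Finset.prod_le_one (fun i _ => (hF i).le) fun i _ => ?_)
  rcases eq_or_back_mem_posGrid hh hy₀ i with hi | hi
  · exact (schemeFactor_of_eq hh hi).le
  · refine add_le_of_nonpos_right (mul_nonpos_of_nonneg_of_nonpos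
      (schemeFactor_coeff_nonneg hh hy₀ i) ?_)
    rw [sub_nonpos, one_le_div hpos]
    exact hmin _ hi

/-- Discrete Lipschitz estimate, upper half: at a maximum point `y` of
`z y / z (y - h e_k)` every factor of the scheme at `y` dominates the one at `y - h e_k`, so the
ratio of the values of `z` is at most that of the values of `f`. -/
lemma IsQuotientSolution.le_mul_back (hh : 0 < h) (hK : 0 ≤ K) (hz : IsQuotientSolution h f z)
    (hf : ∀ x ∈ cube n, 0 < f x)
    (hfK : ∀ k, ∀ y ∈ posGrid n h, back h k y ∈ posGrid n h → f y ≤ (1 + K * h) * f (back h k y))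
    {k : Fin n} (hy : y ∈ posGrid n h) (hyk : back h k y ∈ posGrid n h) :
    z y ≤ (1 + K * h) * z (back h k y) := by
  obtain ⟨y₀, ⟨hy₀, hyk₀⟩, hmax⟩ := Set.exists_max_image
    {y | y ∈ posGrid n h ∧ back h k y ∈ posGrid n h} (fun y => z y / z (back h k y))
    ((posGrid_finite hh).subset fun _ h => h.1) ⟨y, hy, hyk⟩
  have hp := (hz _ hyk).1
  rw [← div_le_iff₀ hp]
  refine (hmax y ⟨hy, hyk⟩).trans ?_
  by_contra! hlt
  obtain ⟨hpos, hF, heq⟩ := hz _ hy₀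
  obtain ⟨hpos', hF', heq'⟩ := hz _ hyk₀
  have hKh : 0 ≤ K * h := by positivity
  have hgt : z (back h k y₀) < z y₀ := by
    rw [lt_div_iff₀ hpos'] at hlt
    nlinarith
  have hprod : ∏ i, schemeFactor h z i (back h k y₀) ≤ ∏ i, schemeFactor h z i y₀ := by
    refine Finset.prod_le_prod (fun i _ => (hF' i).le) fun i _ => ?_
    -- Away from the faces the maximality of the ratio at `y₀` compares the neighbours.
    have key : back h i (back h k y₀) ∈ posGrid n h → back h i y₀ ∈ posGrid n h →
        z (back h i y₀) / z y₀ ≤ z (back h i (back h k y₀)) / z (back h k y₀) := by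
      intro h1 h2
      have h3 := hmax (back h i y₀) ⟨h2, by rwa [back_comm]⟩
      have hq1 := (hz _ h1).1
      simp only [back_comm h k i] at h3
      rw [div_le_div_iff₀ hq1 hpos'] at h3
      rw [div_le_div_iff₀ hpos hpos']
      linarith
    by_cases hik : i = k
    · subst hik
      have hc := schemeFactor_coeff_nonneg hh hy₀ i
      have hr : 0 ≤ 1 - z (back h i y₀) / z y₀ := by
        rw [sub_nonneg, div_le_one hpos]; exact hgt.le
      rcases eq_or_back_mem_posGrid hh hyk₀ i with hi | hi
      · rw [schemeFactor_of_eq hh hi, schemeFactor]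
        exact le_add_of_nonneg_right (mul_nonneg hc hr)
      · have hk := key hi hyk₀
        have hc' := schemeFactor_coeff_nonneg hh hyk₀ i
        simp only [schemeFactor]
        have hcoef : back h i y₀ i / h - 1 ≤ y₀ i / h - 1 := by
          rw [back_self, sub_div, div_self hh.ne']; linarith
        have := mul_le_mul_of_nonneg_left
          (sub_le_sub_left hk 1) hc'
        have := mul_le_mul_of_nonneg_right hcoef hr
        linarith
    · rcases eq_or_back_mem_posGrid hh hy₀ i with hi | hi
      · rw [schemeFactor_of_eq hh hi, schemeFactor_of_eq hh (by rw [back_of_ne h hik, hi])]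
      · have hi' : back h i (back h k y₀) ∈ posGrid n h :=
          back_mem_posGrid hh hyk₀
            (by rw [back_of_ne h hik]; exact lt_apply_of_back_mem_posGrid hi)
        simp only [schemeFactor]
        rw [back_of_ne h hik]
        exact add_le_add_right (mul_le_mul_of_nonneg_left (sub_le_sub_left (key hi' hi) 1)
          (schemeFactor_coeff_nonneg hh hy₀ i)) 1
  have hfy := hfK k _ hy₀ hyk₀
  have hfp := hf _ (posGrid_subset_cube hyk₀)
  have hP' : 0 < ∏ i, schemeFactor h z i (back h k y₀) := Finset.prod_pos fun i _ => hF' i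
  rw [lt_div_iff₀ hpos'] at hlt
  have : (1 + K * h) * f (back h k y₀) < f y₀ := by
    rw [← heq, ← heq', ← mul_assoc]
    exact (mul_lt_mul_of_pos_right hlt hP').trans_le (mul_le_mul_of_nonneg_left hprod hpos.le)
  linarith

/-- Discrete Lipschitz estimate, lower half. -/
lemma IsQuotientSolution.back_le_mul (hh : 0 < h) (hK : 0 ≤ K) (hz : IsQuotientSolution h f z)
    (hf : ∀ x ∈ cube n, 0 < f x)
    (hfK : ∀ k, ∀ y ∈ posGrid n h, back h k y ∈ posGrid n h → f (back h k y) ≤ (1 + K * h) * f y)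
    {k : Fin n} (hy : y ∈ posGrid n h) (hyk : back h k y ∈ posGrid n h) :
    z (back h k y) ≤ (1 + K * h) * z y := by
  obtain ⟨y₀, ⟨hy₀, hyk₀⟩, hmax⟩ := Set.exists_max_image
    {y | y ∈ posGrid n h ∧ back h k y ∈ posGrid n h} (fun y => z (back h k y) / z y)
    ((posGrid_finite hh).subset fun _ h => h.1) ⟨y, hy, hyk⟩
  have hp := (hz _ hy).1
  rw [← div_le_iff₀ hp]
  refine (hmax y ⟨hy, hyk⟩).trans ?_
  by_contra! hlt
  obtain ⟨hpos, hF, heq⟩ := hz _ hy₀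
  obtain ⟨hpos', hF', heq'⟩ := hz _ hyk₀
  have hKh : 0 ≤ K * h := by positivity
  have hgt : z y₀ < z (back h k y₀) := by
    rw [lt_div_iff₀ hpos] at hlt
    nlinarith
  have hprod : ∏ i, schemeFactor h z i y₀ ≤ ∏ i, schemeFactor h z i (back h k y₀) := by
    refine Finset.prod_le_prod (fun i _ => (hF i).le) fun i _ => ?_
    have key : back h i (back h k y₀) ∈ posGrid n h → back h i y₀ ∈ posGrid n h →
        z (back h i (back h k y₀)) / z (back h k y₀) ≤ z (back h i y₀) / z y₀ := by
      intro h1 h2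
      have h3 := hmax (back h i y₀) ⟨h2, by rwa [back_comm]⟩
      have hq1 := (hz _ h2).1
      simp only [back_comm h k i] at h3
      rw [div_le_div_iff₀ hq1 hpos] at h3
      rw [div_le_div_iff₀ hpos' hpos]
      linarith
    by_cases hik : i = k
    · subst hik
      have hc := schemeFactor_coeff_nonneg hh hy₀ i
      have hr : 1 - z (back h i y₀) / z y₀ ≤ 0 := by
        rw [sub_nonpos, one_le_div hpos]; exact hgt.le
      rcases eq_or_back_mem_posGrid hh hyk₀ i with hi | hi
      · rw [schemeFactor_of_eq hh hi, schemeFactor]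
        exact add_le_of_nonpos_right (mul_nonpos_of_nonneg_of_nonpos hc hr)
      · have hk := key hi hyk₀
        have hc' := schemeFactor_coeff_nonneg hh hyk₀ i
        simp only [schemeFactor]
        have hcoef : back h i y₀ i / h - 1 ≤ y₀ i / h - 1 := by
          rw [back_self, sub_div, div_self hh.ne']; linarith
        have := mul_le_mul_of_nonneg_left
          (sub_le_sub_left hk 1) hc'
        have := mul_le_mul_of_nonpos_right hcoef hr
        linarith
    · rcases eq_or_back_mem_posGrid hh hy₀ i with hi | hi
      · rw [schemeFactor_of_eq hh hi, schemeFactor_of_eq hh (by rw [back_of_ne h hik, hi])]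
      · have hi' : back h i (back h k y₀) ∈ posGrid n h :=
          back_mem_posGrid hh hyk₀
            (by rw [back_of_ne h hik]; exact lt_apply_of_back_mem_posGrid hi)
        simp only [schemeFactor]
        rw [back_of_ne h hik]
        exact add_le_add_right (mul_le_mul_of_nonneg_left (sub_le_sub_left (key hi' hi) 1)
          (schemeFactor_coeff_nonneg hh hy₀ i)) 1
  have hfy := hfK k _ hy₀ hyk₀
  have hfp := hf _ (posGrid_subset_cube hy₀)
  have hP : 0 < ∏ i, schemeFactor h z i y₀ := Finset.prod_pos fun i _ => hF i
  rw [lt_div_iff₀ hpos] at hlt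
  have : (1 + K * h) * f y₀ < f (back h k y₀) := by
    rw [← heq, ← heq', ← mul_assoc]
    exact (mul_lt_mul_of_pos_right hlt hP).trans_le (mul_le_mul_of_nonneg_left hprod hpos'.le)
  linarith

end QuotientScheme

/-! ### Logarithmic test functions -/

/-- The squared Euclidean distance, as a sum over the coordinates. -/
noncomputable def sqDist (x y : EuclideanSpace ℝ (Fin n)) : ℝ := ∑ i, (x i - y i) ^ 2

/-- The quotient `(u/n)^n / ∏ (x_i + τ)`, with the faces of the cube shifted by `τ`. -/
noncomputable def shiftQuotient (τ : ℝ) (u : EuclideanSpace ℝ (Fin n) → ℝ)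
    (x : EuclideanSpace ℝ (Fin n)) : ℝ :=
  (u x / n) ^ n / ∏ i, (x i + τ)

/-- The function `∑ (log (x_i + τ) + κ (x_i - b_i)^2)`. Touching `u` by `c exp (logProfile / n)` amounts
to touching the quotient `shiftQuotient τ u` by a multiple of `exp (κ |x - b|^2)`. -/
noncomputable def logProfile (τ κ : ℝ) (b x : EuclideanSpace ℝ (Fin n)) : ℝ :=
  ∑ i, (Real.log (x i + τ) + κ * (x i - b i) ^ 2)

lemma exp_logProfile {τ : ℝ} (κ : ℝ) (b : EuclideanSpace ℝ (Fin n))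
    {x : EuclideanSpace ℝ (Fin n)} (hx : ∀ i, 0 < x i + τ) :
    Real.exp (logProfile τ κ b x) = (∏ i, (x i + τ)) * Real.exp (κ * sqDist x b) := by
  rw [logProfile, Finset.sum_add_distrib, Real.exp_add, Real.exp_sum, sqDist, Finset.mul_sum]
  congr 1
  exact Finset.prod_congr rfl fun i _ => Real.exp_log (hx i)

/-- A function that is `C¹` near a point agrees near it with a globally `C¹` function. -/
lemma exists_contDiff_eventuallyEq {E : Type*} [NormedAddCommGroup E] [InnerProductSpace ℝ E]
    {g : E → ℝ} {x : E} (hg : ContDiffAt ℝ 1 g x) :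
    ∃ φ : E → ℝ, ContDiff ℝ 1 φ ∧ φ =ᶠ[𝓝 x] g := by
  obtain ⟨r, hr, hball⟩ := Metric.eventually_nhds_iff_ball.1 (hg.eventually (by simp))
  let B : ContDiffBump x := ⟨r / 4, r / 2, by positivity, by linarith⟩
  refine ⟨fun y => B y * g y, contDiff_iff_contDiffAt.2 fun y => ?_, ?_⟩
  · by_cases hy : y ∈ tsupport B
    · rw [B.tsupport_eq] at hy
      refine B.contDiffAt.mul (hball y ?_)
      exact Metric.closedBall_subset_ball (show r / 2 < r by linarith) hy
    · refine (contDiffAt_const (c := (0 : ℝ))).congr_of_eventuallyEq ?_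
      filter_upwards [notMem_tsupport_iff_eventuallyEq.1 hy] with w hw
      simp [hw]
  · filter_upwards [B.eventuallyEq_one] with y hy
    simp [hy]

lemma exists_logTest {τ : ℝ} (κ c : ℝ) (b : EuclideanSpace ℝ (Fin n))
    {x : EuclideanSpace ℝ (Fin n)} (hx : ∀ i, 0 < x i + τ) :
    ∃ φ : EuclideanSpace ℝ (Fin n) → ℝ, ContDiff ℝ 1 φ ∧
      (∀ᶠ w in 𝓝 x, φ w = c * Real.exp (logProfile τ κ b w / n)) ∧
      ∀ i, partialDeriv φ i x = c * Real.exp (logProfile τ κ b x / n) *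
        ((1 / (x i + τ) + 2 * κ * (x i - b i)) / n) := by
  have hproj : ∀ i : Fin n, HasFDerivAt (fun w : EuclideanSpace ℝ (Fin n) => w i)
      (EuclideanSpace.proj i : EuclideanSpace ℝ (Fin n) →L[ℝ] ℝ) x := fun i =>
    (EuclideanSpace.proj i : EuclideanSpace ℝ (Fin n) →L[ℝ] ℝ).hasFDerivAt
  have hder : HasFDerivAt (logProfile τ κ b)
      (∑ i, (1 / (x i + τ) + 2 * κ * (x i - b i)) •
        (EuclideanSpace.proj i : EuclideanSpace ℝ (Fin n) →L[ℝ] ℝ)) x := by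
    refine HasFDerivAt.fun_sum fun i _ => ?_
    have h1 : HasDerivAt (fun t : ℝ => Real.log (t + τ) + κ * (t - b i) ^ 2)
        (1 / (x i + τ) + 2 * κ * (x i - b i)) (x i) := by
      have hl := ((hasDerivAt_id (x i)).add_const τ).log (hx i).ne'
      have hq := ((((hasDerivAt_id (x i)).sub_const (b i)).pow 2).const_mul κ)
      refine (hl.add hq).congr_deriv ?_
      simp; ring
    exact h1.comp_hasFDerivAt x (hproj i)
  have hsmooth : ContDiffAt ℝ 1 (fun w => c * Real.exp (logProfile τ κ b w / n)) x := by
    have hp : ContDiffAt ℝ 1 (logProfile τ κ b) x := by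
      refine ContDiffAt.sum fun i _ => ?_
      have hc : ContDiffAt ℝ 1 (fun w : EuclideanSpace ℝ (Fin n) => w i) x :=
        (EuclideanSpace.proj i : EuclideanSpace ℝ (Fin n) →L[ℝ] ℝ).contDiff.contDiffAt
      exact ((hc.add contDiffAt_const).log (hx i).ne').add
        (contDiffAt_const.mul ((hc.sub contDiffAt_const).pow 2))
    exact contDiffAt_const.mul (hp.div_const _).exp
  obtain ⟨φ, hφ, hφe⟩ := exists_contDiff_eventuallyEq hsmooth
  refine ⟨φ, hφ, hφe, fun i => ?_⟩
  have hd := ((hder.const_mul ((n : ℝ)⁻¹)).exp).const_mul c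
  simp only [← div_eq_inv_mul] at hd
  rw [partialDeriv, hφe.fderiv_eq, hd.fderiv]
  simp [PiLp.single_apply]
  ring

lemma prod_max_logTest (hn : n ≠ 0) {τ κ : ℝ} {b x : EuclideanSpace ℝ (Fin n)}
    (hx : ∀ i, 0 < x i + τ) (hu : 0 < u x) :
    ∏ i, max (u x * ((1 / (x i + τ) + 2 * κ * (x i - b i)) / n)) 0 =
      shiftQuotient τ u x * ∏ i, max (1 + (x i + τ) * (2 * κ * (x i - b i))) 0 := by
  have hn' : (0 : ℝ) < n := by positivity
  have hfac : ∀ i, max (u x * ((1 / (x i + τ) + 2 * κ * (x i - b i)) / n)) 0 =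
      u x / n / (x i + τ) * max (1 + (x i + τ) * (2 * κ * (x i - b i))) 0 := by
    intro i
    have h1 := hx i
    rw [mul_max_of_nonneg _ _ (by positivity), mul_zero]
    congr 1
    field_simp
  simp only [hfac]
  rw [Finset.prod_mul_distrib, Finset.prod_div_distrib, Finset.prod_const, Finset.card_univ,
    Fintype.card_fin, shiftQuotient]

lemma shiftQuotient_mul_exp (hn : n ≠ 0) {τ κ : ℝ} {b x : EuclideanSpace ℝ (Fin n)}
    (hx : ∀ i, 0 < x i + τ) :
    shiftQuotient τ u x * Real.exp (-κ * sqDist x b) =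
      (u x * Real.exp (-(logProfile τ κ b x / n)) / n) ^ n := by
  have hn' : (n : ℝ) ≠ 0 := by positivity
  rw [shiftQuotient, mul_div_right_comm, mul_pow, ← Real.exp_nat_mul, mul_neg,
    mul_div_cancel₀ _ hn', Real.exp_neg, exp_logProfile κ b hx, mul_inv, ← Real.exp_neg, neg_mul,
    div_eq_mul_inv]
  ring

/-- The subsolution inequality read on the quotient. -/
lemma IsViscositySubsolution.shiftQuotient_mul_prod_le (hn : n ≠ 0)
    (hu : IsViscositySubsolution f u) (hu0 : ∀ x ∈ cube n, 0 ≤ u x) {τ κ : ℝ}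
    {b x : EuclideanSpace ℝ (Fin n)} (hx : x ∈ halfOpenCube n) (hxτ : ∀ i, 0 < x i + τ)
    (hux : 0 < u x)
    (hmax : ∀ᶠ w in 𝓝[halfOpenCube n] x, shiftQuotient τ u w * Real.exp (-κ * sqDist w b) ≤
      shiftQuotient τ u x * Real.exp (-κ * sqDist x b)) :
    shiftQuotient τ u x * ∏ i, max (1 + (x i + τ) * (2 * κ * (x i - b i))) 0 ≤ f x := by
  have hn' : (0 : ℝ) < n := by positivity
  obtain ⟨φ, hφ, hφe, hφd⟩ :=
    exists_logTest κ (u x * Real.exp (-(logProfile τ κ b x / n))) b hxτ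
  have hcancel : u x * Real.exp (-(logProfile τ κ b x / n)) * Real.exp (logProfile τ κ b x / n)
      = u x := by
    rw [mul_assoc, ← Real.exp_add, neg_add_cancel, Real.exp_zero, mul_one]
  have hpos : ∀ᶠ w in 𝓝 x, ∀ i, 0 < w i + τ := by
    rw [eventually_all]
    intro i
    have hc : Continuous fun w : EuclideanSpace ℝ (Fin n) => w i + τ := by fun_prop
    exact hc.continuousAt.eventually (lt_mem_nhds (hxτ i))
  have hloc : IsLocalMaxOn (fun y => u y - φ y) (halfOpenCube n) x := by
    filter_upwards [hmax, hφe.filter_mono nhdsWithin_le_nhds,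
      hpos.filter_mono nhdsWithin_le_nhds, self_mem_nhdsWithin] with w hw hwφ hwτ hwc
    rw [hwφ, hφe.self_of_nhds, hcancel, sub_self, sub_nonpos]
    rw [shiftQuotient_mul_exp hn hwτ, shiftQuotient_mul_exp hn hxτ] at hw
    have huw : 0 ≤ u w := hu0 w fun i => ⟨(hwc i).1.le, (hwc i).2⟩
    have h1 := (pow_le_pow_iff_left₀ (by positivity) (by positivity) hn).1 hw
    rw [div_le_div_iff_of_pos_right hn'] at h1
    calc u w = u w * Real.exp (-(logProfile τ κ b w / n)) * Real.exp (logProfile τ κ b w / n) := by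
          rw [mul_assoc, ← Real.exp_add, neg_add_cancel, Real.exp_zero, mul_one]
      _ ≤ _ := mul_le_mul_of_nonneg_right h1 (Real.exp_pos _).le
  have := hu.2.2 φ hφ x hx hloc
  simp only [hφd, hcancel] at this
  rwa [prod_max_logTest hn hxτ hux] at this

/-- The supersolution inequality read on the quotient. -/
lemma IsViscositySupersolution.le_shiftQuotient_mul_prod (hn : n ≠ 0)
    (hu : IsViscositySupersolution f u) (hu0 : ∀ x ∈ cube n, 0 ≤ u x) {τ κ : ℝ}
    {b x : EuclideanSpace ℝ (Fin n)} (hx : x ∈ halfOpenCube n) (hxτ : ∀ i, 0 < x i + τ)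
    (hux : 0 < u x)
    (hmin : ∀ᶠ w in 𝓝[halfOpenCube n] x, shiftQuotient τ u x * Real.exp (-κ * sqDist x b) ≤
      shiftQuotient τ u w * Real.exp (-κ * sqDist w b)) :
    f x ≤ shiftQuotient τ u x * ∏ i, max (1 + (x i + τ) * (2 * κ * (x i - b i))) 0 := by
  have hn' : (0 : ℝ) < n := by positivity
  obtain ⟨φ, hφ, hφe, hφd⟩ :=
    exists_logTest κ (u x * Real.exp (-(logProfile τ κ b x / n))) b hxτ
  have hcancel : u x * Real.exp (-(logProfile τ κ b x / n)) * Real.exp (logProfile τ κ b x / n)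
      = u x := by
    rw [mul_assoc, ← Real.exp_add, neg_add_cancel, Real.exp_zero, mul_one]
  have hpos : ∀ᶠ w in 𝓝 x, ∀ i, 0 < w i + τ := by
    rw [eventually_all]
    intro i
    have hc : Continuous fun w : EuclideanSpace ℝ (Fin n) => w i + τ := by fun_prop
    exact hc.continuousAt.eventually (lt_mem_nhds (hxτ i))
  have hloc : IsLocalMinOn (fun y => u y - φ y) (halfOpenCube n) x := by
    filter_upwards [hmin, hφe.filter_mono nhdsWithin_le_nhds,
      hpos.filter_mono nhdsWithin_le_nhds, self_mem_nhdsWithin] with w hw hwφ hwτ hwc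
    rw [hwφ, hφe.self_of_nhds, hcancel, sub_self, sub_nonneg]
    rw [shiftQuotient_mul_exp hn hwτ, shiftQuotient_mul_exp hn hxτ] at hw
    have huw : 0 ≤ u w := hu0 w fun i => ⟨(hwc i).1.le, (hwc i).2⟩
    have h1 := (pow_le_pow_iff_left₀ (by positivity) (by positivity) hn).1 hw
    rw [div_le_div_iff_of_pos_right hn'] at h1
    calc _ ≤ u w * Real.exp (-(logProfile τ κ b w / n)) * Real.exp (logProfile τ κ b w / n) :=
          mul_le_mul_of_nonneg_right h1 (Real.exp_pos _).le
      _ = u w := by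
          rw [mul_assoc, ← Real.exp_add, neg_add_cancel, Real.exp_zero, mul_one]
  have := hu.2.2 φ hφ x hx hloc
  simp only [hφd, hcancel] at this
  rwa [prod_max_logTest hn hxτ hux] at this

/-! ### Positivity and bounds for the viscosity solution -/

lemma isCompact_subcube (n : ℕ) (δ : ℝ) : IsCompact (subcube n δ) := by
  have h1 : IsCompact (Set.univ.pi fun _ : Fin n => Set.Icc δ 1) :=
    isCompact_univ_pi fun _ => isCompact_Icc
  convert h1.image (PiLp.continuous_toLp 2 fun _ : Fin n => ℝ)
  ext x
  constructor
  · exact fun hx => ⟨x.ofLp, fun i _ => hx i, rfl⟩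
  · rintro ⟨y, hy, rfl⟩ i
    exact hy i trivial

lemma isCompact_cube (n : ℕ) : IsCompact (cube n) := isCompact_subcube n 0

lemma IsViscositySolution.continuousOn (hu : IsViscositySolution f u) : ContinuousOn u (cube n) :=
  continuousOn_iff_lower_upperSemicontinuousOn.2 ⟨hu.2.1, hu.1.1⟩

lemma IsViscositySolution.eq_zero (hu : IsViscositySolution f u) {x : EuclideanSpace ℝ (Fin n)}
    (hx : x ∈ cube n) (hx' : x ∉ halfOpenCube n) : u x = 0 :=
  le_antisymm (hu.1.2.1 x (mem_Gam_of_notMem_halfOpenCube hx hx'))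
    (hu.2.2.1 x (mem_Gam_of_notMem_halfOpenCube hx hx'))

lemma IsViscositySolution.nonneg (hn : n ≠ 0) (hu : IsViscositySolution f u)
    (hmono : IsNondecreasing u) {x : EuclideanSpace ℝ (Fin n)} (hx : x ∈ cube n) : 0 ≤ u x := by
  have h0 : (0 : EuclideanSpace ℝ (Fin n)) ∈ cube n := fun i => by simp
  have h0' : (0 : EuclideanSpace ℝ (Fin n)) ∉ halfOpenCube n := fun hmem => by
    simpa using (hmem ⟨0, Nat.pos_of_ne_zero hn⟩).1
  rw [← hu.eq_zero h0 h0']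
  exact hmono 0 h0 x hx fun i => by simpa using (hx i).1

/-- A zero of `u` in `(0,1]^n` would be a minimum, where the constant test function contradicts
`f > 0`. -/
lemma IsViscositySolution.pos (hn : n ≠ 0) (hf : ∀ x ∈ cube n, 0 < f x)
    (hu : IsViscositySolution f u) (hmono : IsNondecreasing u)
    {x : EuclideanSpace ℝ (Fin n)} (hx : x ∈ halfOpenCube n) : 0 < u x := by
  refine lt_of_le_of_ne (hu.nonneg hn hmono (halfOpenCube_subset_cube hx)) fun h0 => ?_
  have hmin : IsLocalMinOn (fun y => u y - (fun _ => (0 : ℝ)) y) (halfOpenCube n) x := by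
    filter_upwards [self_mem_nhdsWithin] with w hw
    simpa [← h0] using hu.nonneg hn hmono (halfOpenCube_subset_cube hw)
  have h1 := hu.2.2.2 (fun _ => 0) contDiff_const x hx hmin
  rw [Finset.prod_eq_zero (Finset.mem_univ (⟨0, Nat.pos_of_ne_zero hn⟩ : Fin n))
    (by simp [partialDeriv])] at h1
  exact (hf x (halfOpenCube_subset_cube hx)).not_ge h1

lemma continuous_sqDist (b : EuclideanSpace ℝ (Fin n)) : Continuous fun x => sqDist x b := by
  unfold sqDist; fun_prop

lemma continuousOn_shiftQuotient {σ : ℝ} (hσ : 0 < σ) (hu : IsViscositySolution f u) :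
    ContinuousOn (shiftQuotient σ u) (cube n) := by
  refine ((hu.continuousOn.div_const _).pow n).div (by fun_prop) fun x hx => ?_
  exact (Finset.prod_pos fun i _ => by linarith [(hx i).1]).ne'

lemma shiftQuotient_pos (hn : n ≠ 0) {τ : ℝ} {x : EuclideanSpace ℝ (Fin n)}
    (hx : ∀ i, 0 < x i + τ) (hu : 0 < u x) : 0 < shiftQuotient τ u x := by
  have hn' : (0 : ℝ) < n := by positivity
  exact div_pos (by positivity) (Finset.prod_pos fun i _ => hx i)

lemma IsViscositySolution.mem_halfOpenCube (hn : n ≠ 0) (hu : IsViscositySolution f u) {σ : ℝ}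
    {x : EuclideanSpace ℝ (Fin n)} (hx : x ∈ cube n) (hpos : 0 < shiftQuotient σ u x) :
    x ∈ halfOpenCube n := by
  by_contra hx'
  rw [shiftQuotient, hu.eq_zero hx hx'] at hpos
  simp [hn] at hpos

/-- Maximum principle for the quotient of a viscosity solution. -/
lemma IsViscositySolution.shiftQuotient_le (hn : n ≠ 0) (hf : ∀ x ∈ cube n, 0 < f x)
    (hu : IsViscositySolution f u) (hmono : IsNondecreasing u) {M σ : ℝ} (hσ : 0 < σ)
    (hfM : ∀ x ∈ cube n, f x ≤ M) {x : EuclideanSpace ℝ (Fin n)} (hx : x ∈ cube n) :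
    shiftQuotient σ u x ≤ M := by
  obtain ⟨x₀, hx₀, hmax⟩ := (isCompact_cube n).exists_isMaxOn ⟨x, hx⟩
    (continuousOn_shiftQuotient hσ hu)
  refine (hmax hx).trans ?_
  rcases le_or_gt (shiftQuotient σ u x₀) 0 with h0 | h0
  · exact h0.trans ((hf x hx).le.trans (hfM x hx))
  · have hx₀' := hu.mem_halfOpenCube hn hx₀ h0
    have := hu.1.shiftQuotient_mul_prod_le hn (fun w hw => hu.nonneg hn hmono hw)
      (τ := σ) (κ := 0) (b := 0) hx₀' (fun i => by linarith [(hx₀ i).1])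
      (hu.pos hn hf hmono hx₀') (by
        filter_upwards [self_mem_nhdsWithin] with w hw
        simpa using hmax (halfOpenCube_subset_cube hw))
    simp at this
    exact this.trans (hfM x₀ hx₀)

/-! ### Doubling of variables -/

lemma prod_le_prod_add {ι : Type*} (s : Finset ι) {A b : ι → ℝ} {e R : ℝ} (he : 0 ≤ e)
    (hR : 1 ≤ R) (hA : ∀ i, 0 ≤ A i) (hAR : ∀ i, A i ≤ R) (hb : ∀ i, 0 ≤ b i)
    (hbR : ∀ i, b i ≤ R) (hAb : ∀ i, A i ≤ b i + e) :
    ∏ i ∈ s, A i ≤ ∏ i ∈ s, b i + s.card * e * R ^ s.card := by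
  classical
  induction s using Finset.induction_on with
  | empty => simp
  | insert j s hj ih =>
    rw [Finset.prod_insert hj, Finset.prod_insert hj, Finset.card_insert_of_notMem hj]
    have hP : ∏ i ∈ s, A i ≤ R ^ s.card := 
      (Finset.prod_le_prod (fun i _ => hA i) fun i _ => hAR i).trans_eq (by simp)
    have hP0 : 0 ≤ ∏ i ∈ s, A i := Finset.prod_nonneg fun i _ => hA i
    have h1 : A j * ∏ i ∈ s, A i ≤ (b j + e) * ∏ i ∈ s, A i :=
      mul_le_mul_of_nonneg_right (hAb j) hP0
    have h2 : b j * ∏ i ∈ s, A i ≤ b j * (∏ i ∈ s, b i + s.card * e * R ^ s.card) :=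
      mul_le_mul_of_nonneg_left ih (hb j)
    have h3 : e * ∏ i ∈ s, A i ≤ e * R ^ s.card := mul_le_mul_of_nonneg_left hP he
    have h4 : b j * (s.card * e * R ^ s.card) ≤ R * (s.card * e * R ^ s.card) :=
      mul_le_mul_of_nonneg_right (hbR j) (by positivity)
    have h5 : e * R ^ s.card ≤ e * R ^ (s.card + 1) :=
      mul_le_mul_of_nonneg_left (pow_le_pow_right₀ hR (Nat.le_succ _)) he
    have h6 : R * (s.card * e * R ^ s.card) = s.card * e * R ^ (s.card + 1) := by ring
    push_cast
    linarith

lemma sqDist_back (x y : EuclideanSpace ℝ (Fin n)) (i : Fin n) :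
    sqDist x (back h i y) = sqDist x y + (2 * h * (x i - y i) + h ^ 2) := by
  have : ∀ j, (x j - back h i y j) ^ 2 = (x j - y j) ^ 2 +
      if j = i then 2 * h * (x j - y j) + h ^ 2 else 0 := by
    intro j
    rw [back_apply]
    split_ifs <;> ring
  simp only [sqDist, this, Finset.sum_add_distrib, Finset.sum_ite_eq', Finset.mem_univ, if_true]

lemma sqDist_self (x : EuclideanSpace ℝ (Fin n)) : sqDist x x = 0 := by simp [sqDist]

lemma sqDist_nonneg (x y : EuclideanSpace ℝ (Fin n)) : 0 ≤ sqDist x y :=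
  Finset.sum_nonneg fun _ _ => sq_nonneg _

lemma mul_sub_le_of_mul_exp_le {a b κ S T r : ℝ} (hb : 0 < b)
    (hab : a ≤ (1 + r) * b) (hmax : b * Real.exp (-κ * T) ≤ a * Real.exp (-κ * S)) :
    κ * (S - T) ≤ r := by
  have h1 : b * Real.exp (-κ * T) ≤ b * Real.exp (r + -κ * S) := by
    rw [Real.exp_add]
    have h2 : 1 + r ≤ Real.exp r := by linarith [Real.add_one_le_exp r]
    have h3 := Real.exp_pos (-κ * S)
    calc _ ≤ _ := hmax
      _ ≤ (1 + r) * b * Real.exp (-κ * S) := mul_le_mul_of_nonneg_right hab h3.le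
      _ ≤ Real.exp r * b * Real.exp (-κ * S) := by gcongr
      _ = _ := by ring
  have h4 := Real.exp_le_exp.1 (le_of_mul_le_mul_left h1 hb)
  linarith

/-- The penalization at a maximum point is controlled by the Lipschitz bound for the grid
function. -/
lemma abs_sub_le_of_isMax {ζ : EuclideanSpace ℝ (Fin n) → ℝ} {K ε : ℝ} (hh : 0 < h) (hK : 0 ≤ K)
    (hε : 0 < ε) (hζ : ∀ y ∈ posGrid n h, 0 < ζ y)
    (hle : ∀ k, ∀ y ∈ posGrid n h, back h k y ∈ posGrid n h → ζ y ≤ (1 + K * h) * ζ (back h k y))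
    (hge : ∀ k, ∀ y ∈ posGrid n h, back h k y ∈ posGrid n h → ζ (back h k y) ≤ (1 + K * h) * ζ y)
    {x y : EuclideanSpace ℝ (Fin n)} (hx : x ∈ cube n) (hy : y ∈ posGrid n h)
    (hmax : ∀ y' ∈ posGrid n h, ζ y' * Real.exp (-(1 / (2 * ε)) * sqDist x y') ≤
      ζ y * Real.exp (-(1 / (2 * ε)) * sqDist x y)) (i : Fin n) :
    |x i - y i| ≤ ε * K + h := by
  have hεK : 0 ≤ ε * K := by positivity
  rw [abs_le]
  constructor
  · rcases eq_or_back_mem_posGrid hh hy i with hi | hi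
    · linarith [(hx i).1]
    · have h1 := mul_sub_le_of_mul_exp_le (hζ _ hi) (hle i y hy hi) (hmax _ hi)
      rw [sqDist_back, one_div, inv_mul_le_iff₀ (by positivity)] at h1
      have h2 : h * (-2 * (x i - y i) - h) ≤ h * (2 * ε * K) := by linarith
      linarith [le_of_mul_le_mul_left h2 hh]
  · rcases le_or_gt (y i + h) 1 with hi | hi
    · obtain ⟨y', hy', hb⟩ := exists_forward hh hy i hi
      subst hb
      have h1 := mul_sub_le_of_mul_exp_le (hζ _ hy') (hge i _ hy' hy) (hmax _ hy')
      have h0 : sqDist x (back h i y') - sqDist x y' = 2 * h * (x i - back h i y' i) - h ^ 2 := by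
        rw [sqDist_back, back_self]; ring
      rw [h0, one_div, inv_mul_le_iff₀ (by positivity)] at h1
      have h2 : h * (2 * (x i - back h i y' i) - h) ≤ h * (2 * ε * K) := by linarith
      linarith [le_of_mul_le_mul_left h2 hh]
    · linarith [(hx i).2]

lemma exists_isMax_compact_finite {X Y : Type*} [TopologicalSpace X] {S : Set X} {G : Set Y}
    (hS : IsCompact S) (hS' : S.Nonempty) (hG : G.Finite) (hG' : G.Nonempty) {g : X → Y → ℝ}
    (hg : ∀ y ∈ G, ContinuousOn (fun x => g x y) S) :
    ∃ x₀ ∈ S, ∃ y₀ ∈ G, ∀ x ∈ S, ∀ y ∈ G, g x y ≤ g x₀ y₀ := by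
  have h1 : ∀ y, ∃ x, y ∈ G → x ∈ S ∧ ∀ w ∈ S, g w y ≤ g x y := by
    intro y
    by_cases hy : y ∈ G
    · obtain ⟨x, hx, hmax⟩ := hS.exists_isMaxOn hS' (hg y hy)
      exact ⟨x, fun _ => ⟨hx, hmax⟩⟩
    · exact ⟨hS'.some, fun h => absurd h hy⟩
  choose X hX using h1
  obtain ⟨y₀, hy₀, hmax⟩ := Set.exists_max_image G (fun y => g (X y) y) hG hG'
  exact ⟨X y₀, (hX y₀ hy₀).1, y₀, hy₀, fun x hx y hy => ((hX y hy).2 x hx).trans (hmax y hy)⟩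

/-! ### Relative error estimates -/

/-- Bounds on a positive right-hand side: `m ≤ f ≤ M`, and values of `f` at points at
`ℓ¹`-distance `d` have ratio at most `1 + K d`. -/
structure RhsBounds (f : EuclideanSpace ℝ (Fin n) → ℝ) (K m M : ℝ) : Prop where
  K_nonneg : 0 ≤ K
  m_pos : 0 < m
  ge : ∀ x ∈ cube n, m ≤ f x
  le : ∀ x ∈ cube n, f x ≤ M
  le_mul : ∀ x ∈ cube n, ∀ y ∈ cube n, f x ≤ (1 + K * ∑ i, |x i - y i|) * f y

/-- The constant in the relative error estimates. With `s = √h`, doubled points are within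
`(K + 1) s` of each other in each coordinate, the first-order factors are at most
`2 (K + 1) + 1`, and the relevant one exceeds the other by at most
`(2 (K + 1) + 1 + (K + 2)^2 exp (K + 2)) s`. -/
noncomputable def rateConst (n : ℕ) (K m M : ℝ) : ℝ :=
  K * (n * (K + 1)) +
    M * n * (2 * (K + 1) + 1 + (K + 2) ^ 2 * Real.exp (K + 2)) * (2 * (K + 1) + 1) ^ n / m

variable {K m M : ℝ}

lemma RhsBounds.pos (hb : RhsBounds f K m M) : ∀ x ∈ cube n, 0 < f x :=
  fun x hx => hb.m_pos.trans_le (hb.ge x hx)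

lemma sum_abs_sub_back (hh : 0 < h) (y : EuclideanSpace ℝ (Fin n)) (k : Fin n) :
    ∑ i, |y i - back h k y i| = h := by
  have : ∀ i, |y i - back h k y i| = if i = k then h else 0 := by
    intro i
    rw [back_apply]
    split_ifs <;> simp [abs_of_pos hh]
  simp [this]

lemma RhsBounds.le_mul_back (hb : RhsBounds f K m M) (hh : 0 < h)
    (hz : IsQuotientSolution h f z) (k : Fin n) (y : EuclideanSpace ℝ (Fin n))
    (hy : y ∈ posGrid n h) (hyk : back h k y ∈ posGrid n h) :
    z y ≤ (1 + K * h) * z (back h k y) := by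
  refine hz.le_mul_back hh hb.K_nonneg hb.pos (fun k y hy hyk => ?_) hy hyk
  have := hb.le_mul y (posGrid_subset_cube hy) _ (posGrid_subset_cube hyk)
  rwa [sum_abs_sub_back hh] at this

lemma RhsBounds.back_le_mul (hb : RhsBounds f K m M) (hh : 0 < h)
    (hz : IsQuotientSolution h f z) (k : Fin n) (y : EuclideanSpace ℝ (Fin n))
    (hy : y ∈ posGrid n h) (hyk : back h k y ∈ posGrid n h) :
    z (back h k y) ≤ (1 + K * h) * z y := by
  refine hz.back_le_mul hh hb.K_nonneg hb.pos (fun k y hy hyk => ?_) hy hyk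
  have := hb.le_mul _ (posGrid_subset_cube hyk) y (posGrid_subset_cube hy)
  simp only [abs_sub_comm (back h k y _)] at this
  rwa [sum_abs_sub_back hh] at this

lemma RhsBounds.schemeFactor_le (hb : RhsBounds f K m M) (hh : 0 < h)
    (hz : IsQuotientSolution h f z) {y : EuclideanSpace ℝ (Fin n)} (hy : y ∈ posGrid n h)
    (i : Fin n) : schemeFactor h z i y ≤ 1 + K := by
  have hK := hb.K_nonneg
  rcases eq_or_back_mem_posGrid hh hy i with hi | hi
  · rw [schemeFactor_of_eq hh hi]; linarith
  · have h1 := hb.le_mul_back hh hz i y hy hi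
    have hzy := (hz y hy).1
    have h3 : 1 - z (back h i y) / z y ≤ K * h := by
      have : 1 - K * h ≤ z (back h i y) / z y := by
        rw [le_div_iff₀ hzy]
        have h2 := (hz _ hi).1
        rcases le_or_gt (1 - K * h) 0 with h0 | h0
        · nlinarith
        · nlinarith [mul_le_mul_of_nonneg_left h1 h0.le, sq_nonneg (K * h)]
      linarith
    have hc' : (y i / h - 1) * (K * h) = (y i - h) * K := by field_simp
    have hy1 := (hy.1 i).2
    have h4 := mul_le_mul_of_nonneg_left h3 (schemeFactor_coeff_nonneg hh hy i)
    rw [schemeFactor]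
    nlinarith

/-- If the products of the first-order factors at `x` and `y` nearly agree, so do the values of
the quotients there. -/
lemma RhsBounds.le_of_factors (hb : RhsBounds f K m M) {s a b A B : ℝ}
    {x y : EuclideanSpace ℝ (Fin n)} (hx : x ∈ cube n) (hy : y ∈ cube n)
    (hs : 0 < s) (hb0 : 0 < b) (ha : 0 ≤ a) (haM : a ≤ M)
    (hxy : ∀ i, |x i - y i| ≤ s * (K + 1)) (hax : a * A ≤ f x) (hby : f y ≤ b * B)
    (hAB : B ≤ A + n * (s * (2 * (K + 1) + 1 + (K + 2) ^ 2 * Real.exp (K + 2))) *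
      (2 * (K + 1) + 1) ^ n) :
    a ≤ (1 + rateConst n K m M * s) * b := by
  have hK := hb.K_nonneg
  have hm := hb.m_pos
  have hfy := hb.pos y hy
  have hmf := hb.ge y hy
  set D := n * (s * (2 * (K + 1) + 1 + (K + 2) ^ 2 * Real.exp (K + 2))) *
      (2 * (K + 1) + 1) ^ n with hD
  have hD0 : 0 ≤ D := by positivity
  have hsum : ∑ i, |x i - y i| ≤ n * (s * (K + 1)) := by
    refine (Finset.sum_le_card_nsmul _ _ _ fun i _ => hxy i).trans_eq ?_
    simp
  have hfx : f x ≤ (1 + K * (n * (s * (K + 1)))) * f y :=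
    (hb.le_mul x hx y hy).trans (by gcongr)
  have h1 : a * f y ≤ b * f x + b * (M * D) := by
    calc a * f y ≤ a * (b * (A + D)) := by gcongr; exact hby.trans (by gcongr)
      _ = b * (a * A) + b * (a * D) := by ring
      _ ≤ _ := by gcongr
  have hM : 0 ≤ M := ha.trans haM
  have h2 : M * D ≤ M * D / m * f y := by
    rw [div_mul_eq_mul_div, le_div_iff₀ hm]
    gcongr
  have h3 : a * f y ≤ (1 + rateConst n K m M * s) * b * f y := by
    have e : rateConst n K m M * s = K * (n * (s * (K + 1))) + M * D / m := by
      rw [rateConst, hD]; ring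
    rw [e]
    calc a * f y ≤ b * f x + b * (M * D) := h1
      _ ≤ b * ((1 + K * (n * (s * (K + 1)))) * f y) + b * (M * D / m * f y) := by gcongr
      _ = _ := by ring
  exact le_of_mul_le_mul_right h3 hfy

lemma exp_le_one_add_add_sq_mul_exp_abs (t : ℝ) :
    Real.exp t ≤ 1 + t + t ^ 2 * Real.exp |t| := by
  have h1 : Real.exp t - 1 ≤ t * Real.exp t := by
    have h := mul_le_mul_of_nonneg_left (Real.add_one_le_exp (-t)) (Real.exp_pos t).le
    rw [← Real.exp_add, add_neg_cancel, Real.exp_zero] at h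
    linarith
  have h0 := Real.add_one_le_exp t
  rcases le_total 0 t with ht | ht
  · rw [abs_of_nonneg ht]
    nlinarith
  · -- `exp t - 1 ≤ t exp t` and `t (exp t - 1) ≤ t ^ 2` since `t ≤ exp t - 1`.
    have h2 : 1 ≤ Real.exp |t| := Real.one_le_exp (abs_nonneg t)
    nlinarith [sq_nonneg t]

/-- Upper bound for the viscosity solution by the discrete one, up to a shift of the faces. -/
lemma shiftQuotient_le_quotientSolution (hn : n ≠ 0) (hb : RhsBounds f K m M)
    (hu : IsViscositySolution f u) (hmono : IsNondecreasing u) {s σ : ℝ} (hs : 0 < s) (hs1 : s ≤ 1)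
    (hσ : 0 < σ) (hσs : σ ≤ s ^ 2) (hz : IsQuotientSolution (s ^ 2) f z)
    {y : EuclideanSpace ℝ (Fin n)} (hy : y ∈ posGrid n (s ^ 2)) :
    shiftQuotient σ u y ≤ (1 + rateConst n K m M * s) * z y := by
  have hh : 0 < s ^ 2 := by positivity
  have hhs : s ^ 2 ≤ s := by nlinarith
  have hK := hb.K_nonneg
  have hu0 : ∀ x ∈ cube n, 0 ≤ u x := fun x hx => hu.nonneg hn hmono hx
  obtain ⟨x₀, hx₀, y₀, hy₀, hmax⟩ := exists_isMax_compact_finite (isCompact_cube n)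
    ⟨y, posGrid_subset_cube hy⟩ (posGrid_finite hh) ⟨y, hy⟩
    (g := fun x y => shiftQuotient σ u x * Real.exp (-(1 / (2 * s)) * sqDist x y) * (z y)⁻¹)
    (fun b _ => ((continuousOn_shiftQuotient hσ hu).mul
      ((continuous_sqDist b).continuousOn.const_mul _).rexp).mul continuousOn_const)
  have hz₀ := (hz y₀ hy₀).1
  have hzy := (hz y hy).1
  have hyc := posGrid_subset_halfOpenCube hy
  have hQy : 0 < shiftQuotient σ u y :=
    shiftQuotient_pos hn (fun i => by linarith [(hyc i).1]) (hu.pos hn hb.pos hmono hyc)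
  have hmaxy := hmax y (posGrid_subset_cube hy) y hy
  simp only [sqDist_self, mul_zero, Real.exp_zero, mul_one] at hmaxy
  have hQ₀ : 0 < shiftQuotient σ u x₀ := by
    have h1 : 0 < shiftQuotient σ u y * (z y)⁻¹ := by positivity
    have h2 := h1.trans_le hmaxy
    rw [mul_assoc] at h2
    exact (pos_iff_pos_of_mul_pos h2).2 (by positivity)
  have hx₀' := hu.mem_halfOpenCube hn hx₀ hQ₀
  -- The subsolution inequality at `x₀`.
  have hsub := hu.1.shiftQuotient_mul_prod_le hn hu0 (τ := σ) (κ := 1 / (2 * s)) (b := y₀) hx₀'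
    (fun i => by linarith [(hx₀ i).1]) (hu.pos hn hb.pos hmono hx₀') (by
      filter_upwards [self_mem_nhdsWithin] with w hw
      exact le_of_mul_le_mul_right (hmax w (halfOpenCube_subset_cube hw) y₀ hy₀)
        (inv_pos.2 hz₀))
  have hmaxG : ∀ y' ∈ posGrid n (s ^ 2), (z y')⁻¹ * Real.exp (-(1 / (2 * s)) * sqDist x₀ y') ≤
      (z y₀)⁻¹ * Real.exp (-(1 / (2 * s)) * sqDist x₀ y₀) := by
    intro y' hy'
    refine le_of_mul_le_mul_left ?_ hQ₀
    linarith [hmax x₀ hx₀ y' hy']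
  have hdist : ∀ i, |x₀ i - y₀ i| ≤ s * (K + 1) := by
    intro i
    refine (abs_sub_le_of_isMax hh hK hs (fun y hy => inv_pos.2 (hz y hy).1) ?_ ?_ hx₀ hy₀ hmaxG
      i).trans (by linarith)
    · intro k y hy hyk
      have h1 := (hz y hy).1
      have h2 := (hz _ hyk).1
      rw [← div_eq_mul_inv, inv_eq_one_div, div_le_div_iff₀ h1 h2, one_mul]
      exact hb.back_le_mul hh hz k y hy hyk
    · intro k y hy hyk
      have h1 := (hz y hy).1
      have h2 := (hz _ hyk).1
      rw [← div_eq_mul_inv, inv_eq_one_div, div_le_div_iff₀ h2 h1, one_mul]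
      exact hb.le_mul_back hh hz k y hy hyk
  have hp : ∀ i, ∃ p, x₀ i - y₀ i = s * p ∧ |p| ≤ K + 1 := by
    intro i
    refine ⟨(x₀ i - y₀ i) / s, by field_simp, ?_⟩
    rw [abs_div, abs_of_pos hs, div_le_iff₀ hs, mul_comm]
    exact hdist i
  have hprod := prod_le_prod_add (Finset.univ : Finset (Fin n))
    (A := fun i => schemeFactor (s ^ 2) z i y₀)
    (b := fun i => max (1 + (x₀ i + σ) * (2 * (1 / (2 * s)) * (x₀ i - y₀ i))) 0)
    (e := s * (2 * (K + 1) + 1 + (K + 2) ^ 2 * Real.exp (K + 2))) (R := 2 * (K + 1) + 1)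
    (by positivity) (by linarith) (fun i => ((hz y₀ hy₀).2.1 i).le) ?_
    (fun i => le_max_right _ _) ?_ ?_
  · rw [Finset.card_univ, Fintype.card_fin] at hprod
    have hfin := hb.le_of_factors hx₀ (posGrid_subset_cube hy₀) hs hz₀ hQ₀.le
      (hu.shiftQuotient_le hn hb.pos hmono hσ hb.le hx₀) hdist hsub (hz y₀ hy₀).2.2.ge hprod
    have hexp : Real.exp (-(1 / (2 * s)) * sqDist x₀ y₀) ≤ 1 := by
      rw [Real.exp_le_one_iff, neg_mul, neg_nonpos]
      have := sqDist_nonneg x₀ y₀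
      positivity
    rw [← div_le_iff₀ hzy]
    calc shiftQuotient σ u y / z y ≤ _ := hmaxy
      _ ≤ shiftQuotient σ u x₀ * 1 * (z y₀)⁻¹ := by gcongr
      _ ≤ _ := by rwa [mul_one, ← div_eq_mul_inv, div_le_iff₀ hz₀]
  · exact fun i => (hb.schemeFactor_le hh hz hy₀ i).trans (by linarith)
  · intro i
    obtain ⟨p, hpe, hp⟩ := hp i
    rw [hpe]
    have e : 2 * (1 / (2 * s)) * (s * p) = p := by field_simp
    rw [e]
    refine max_le ?_ (by linarith)
    have h1 : (x₀ i + σ) * p ≤ (x₀ i + σ) * (K + 1) :=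
      mul_le_mul_of_nonneg_left ((le_abs_self p).trans hp) (by linarith [(hx₀ i).1])
    have h2 : (x₀ i + σ) * (K + 1) ≤ 2 * (K + 1) :=
      mul_le_mul_of_nonneg_right (by nlinarith [(hx₀ i).2]) (by linarith)
    linarith
  · -- Consistency: the scheme sees the gradient of the penalization up to `O(s)`.
    intro i
    obtain ⟨p, hpe, hp⟩ := hp i
    have e : 2 * (1 / (2 * s)) * (x₀ i - y₀ i) = p := by rw [hpe]; field_simp
    rw [e]
    refine le_trans ?_ (add_le_add_left (le_max_left _ _) _)
    have hpp := abs_le.1 hp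
    have hE : 0 ≤ s * ((K + 2) ^ 2 * Real.exp (K + 2)) := by positivity
    have hF : schemeFactor (s ^ 2) z i y₀ ≤ 1 + (y₀ i - s ^ 2) * (p + s / 2) := by
      rcases eq_or_back_mem_posGrid hh hy₀ i with hi | hi
      · rw [schemeFactor_of_eq hh hi, hi]; simp
      · have h2 := (hz _ hi).1
        have h3 := hmaxG _ hi
        rw [sqDist_back, hpe, mul_add, Real.exp_add, ← mul_assoc, mul_right_comm] at h3
        have h4 := le_of_mul_le_mul_right h3 (Real.exp_pos _)
        have e2 : -(1 / (2 * s)) * (2 * s ^ 2 * (s * p) + (s ^ 2) ^ 2) =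
            -(s ^ 2 * (p + s / 2)) := by field_simp
        rw [e2] at h4
        have h5 : Real.exp (-(s ^ 2 * (p + s / 2))) ≤ z (back (s ^ 2) i y₀) / z y₀ := by
          rw [le_div_iff₀ hz₀]
          rw [inv_mul_le_iff₀ h2, ← div_eq_mul_inv, le_div_iff₀ hz₀] at h4
          exact h4
        have h6 := Real.add_one_le_exp (-(s ^ 2 * (p + s / 2)))
        have h7 : 1 - z (back (s ^ 2) i y₀) / z y₀ ≤ s ^ 2 * (p + s / 2) := by linarith
        have hc' : (y₀ i / s ^ 2 - 1) * (s ^ 2 * (p + s / 2)) = (y₀ i - s ^ 2) * (p + s / 2) := by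
          field_simp
        have := mul_le_mul_of_nonneg_left h7 (schemeFactor_coeff_nonneg hh hy₀ i)
        rw [schemeFactor]
        linarith
    have hy1 := (hy₀.1 i).2
    have e3 : y₀ i = x₀ i - s * p := by linarith
    have h8 : (y₀ i - s ^ 2) * (s / 2) ≤ s / 2 := by nlinarith
    -- The difference of the two linear factors carries the good sign `-s p²`.
    have h9 : (y₀ i - s ^ 2) * p = (x₀ i + σ) * p - s * p ^ 2 - (s ^ 2 + σ) * p := by
      rw [e3]; ring
    have h10 : -((s ^ 2 + σ) * p) ≤ (s ^ 2 + σ) * (K + 1) := by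
      rw [← mul_neg]
      exact mul_le_mul_of_nonneg_left (by linarith) (by positivity)
    have h11 : (s ^ 2 + σ) * (K + 1) ≤ (s + s) * (K + 1) :=
      mul_le_mul_of_nonneg_right (by linarith) (by linarith)
    have h12 : 0 ≤ s * p ^ 2 := by positivity
    linarith

/-- Upper bound for the discrete solution by the viscosity solution, up to a shift of the faces. -/
lemma quotientSolution_le_shiftQuotient (hn : n ≠ 0) (hb : RhsBounds f K m M)
    (hu : IsViscositySolution f u) (hmono : IsNondecreasing u) {s σ : ℝ} (hs : 0 < s) (hs1 : s ≤ 1)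
    (hσ : 0 < σ) (hσs : σ < s ^ 2) (hz : IsQuotientSolution (s ^ 2) f z)
    {y : EuclideanSpace ℝ (Fin n)} (hy : y ∈ posGrid n (s ^ 2)) :
    z y ≤ (1 + rateConst n K m M * s) * shiftQuotient (-σ) u y := by
  have hh : 0 < s ^ 2 := by positivity
  have hhs : s ^ 2 ≤ s := by nlinarith
  have hK := hb.K_nonneg
  have hu0 : ∀ x ∈ cube n, 0 ≤ u x := fun x hx => hu.nonneg hn hmono hx
  have hsubc : ∀ x ∈ subcube n σ, x ∈ halfOpenCube n :=
    fun x hx i => ⟨hσ.trans_le (hx i).1, (hx i).2⟩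
  have hupos : ∀ x ∈ subcube n σ, 0 < u x := fun x hx => hu.pos hn hb.pos hmono (hsubc x hx)
  have hyσ : ∀ y ∈ posGrid n (s ^ 2), ∀ i, σ < y i :=
    fun y hy i => hσs.trans_le (le_apply_of_mem_posGrid hh hy i)
  have hysub : y ∈ subcube n σ := fun i => ⟨(hyσ y hy i).le, (hy.1 i).2⟩
  have hn' : (n : ℝ) ≠ 0 := by positivity
  obtain ⟨x₀, hx₀, y₀, hy₀, hmax⟩ := exists_isMax_compact_finite (isCompact_subcube n σ)
    ⟨y, hysub⟩ (posGrid_finite hh) ⟨y, hy⟩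
    (g := fun x y => (shiftQuotient (-σ) u x)⁻¹ * Real.exp (-(1 / (2 * s)) * sqDist x y) * z y)
    (fun b _ => by
      -- The inverse quotient extends continuously by `0` to the faces `x_i = σ`.
      have hQ : ContinuousOn (fun x => (shiftQuotient (-σ) u x)⁻¹) (subcube n σ) := by
        simp only [shiftQuotient, inv_div]
        refine ContinuousOn.div (by fun_prop)
          (((hu.continuousOn.mono fun x hx =>
            halfOpenCube_subset_cube (hsubc x hx)).div_const _).pow n) fun x hx => ?_
        exact pow_ne_zero n (div_ne_zero (hupos x hx).ne' hn')
      exact (hQ.mul ((continuous_sqDist b).continuousOn.const_mul _).rexp).mul continuousOn_const)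
  have hz₀ := (hz y₀ hy₀).1
  have hzy := (hz y hy).1
  have hQy : 0 < shiftQuotient (-σ) u y :=
    shiftQuotient_pos hn (fun i => by linarith [hyσ y hy i]) (hupos y hysub)
  have hmaxy := hmax y hysub y hy
  simp only [sqDist_self, mul_zero, Real.exp_zero, mul_one] at hmaxy
  have hQ₀ : 0 < shiftQuotient (-σ) u x₀ := by
    have h1 : 0 < (shiftQuotient (-σ) u y)⁻¹ * z y := by positivity
    have h2 := h1.trans_le hmaxy
    rw [mul_assoc] at h2
    exact inv_pos.1 ((pos_iff_pos_of_mul_pos h2).2 (by positivity))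
  have hx₀c : x₀ ∈ cube n := halfOpenCube_subset_cube (hsubc x₀ hx₀)
  have hx₀σ : ∀ i, 0 < x₀ i + -σ := by
    intro i
    refine lt_of_le_of_ne (by linarith [(hx₀ i).1]) fun h0 => ?_
    rw [shiftQuotient, Finset.prod_eq_zero (Finset.mem_univ i) h0.symm, div_zero] at hQ₀
    exact hQ₀.false
  -- The supersolution inequality at `x₀`.
  have hsup := hu.2.le_shiftQuotient_mul_prod hn hu0 (τ := -σ) (κ := -(1 / (2 * s))) (b := y₀)
    (hsubc x₀ hx₀) hx₀σ (hupos x₀ hx₀) (by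
      have hev : ∀ᶠ w in 𝓝[halfOpenCube n] x₀, ∀ i, 0 < w i + -σ := by
        rw [eventually_all]
        intro i
        have hc : Continuous fun w : EuclideanSpace ℝ (Fin n) => w i + -σ := by fun_prop
        exact (hc.continuousAt.eventually (lt_mem_nhds (hx₀σ i))).filter_mono nhdsWithin_le_nhds
      filter_upwards [hev, self_mem_nhdsWithin] with w hw hwc
      have hws : w ∈ subcube n σ := fun i => ⟨by linarith [hw i], (hwc i).2⟩
      have hQw := shiftQuotient_pos hn hw (hupos w hws)
      have h1 := le_of_mul_le_mul_right (hmax w hws y₀ hy₀) hz₀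
      rw [inv_mul_le_iff₀ hQw, ← mul_assoc, ← div_eq_mul_inv, div_mul_eq_mul_div,
        le_div_iff₀ hQ₀, neg_mul, neg_mul, Real.exp_neg, Real.exp_neg,
        inv_mul_le_iff₀ (Real.exp_pos _), ← mul_assoc, ← div_eq_mul_inv,
        le_div_iff₀ (Real.exp_pos _)] at h1
      rw [neg_neg]
      linarith)
  have hmaxG : ∀ y' ∈ posGrid n (s ^ 2), z y' * Real.exp (-(1 / (2 * s)) * sqDist x₀ y') ≤
      z y₀ * Real.exp (-(1 / (2 * s)) * sqDist x₀ y₀) := by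
    intro y' hy'
    refine le_of_mul_le_mul_left ?_ (inv_pos.2 hQ₀)
    linarith [hmax x₀ hx₀ y' hy']
  have hdist : ∀ i, |x₀ i - y₀ i| ≤ s * (K + 1) := fun i =>
    (abs_sub_le_of_isMax hh hK hs (fun y hy => (hz y hy).1)
      (fun k y hy hyk => hb.le_mul_back hh hz k y hy hyk)
      (fun k y hy hyk => hb.back_le_mul hh hz k y hy hyk) hx₀c hy₀ hmaxG i).trans (by linarith)
  have hp : ∀ i, ∃ p, x₀ i - y₀ i = s * p ∧ |p| ≤ K + 1 := by
    intro i
    refine ⟨(x₀ i - y₀ i) / s, by field_simp, ?_⟩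
    rw [abs_div, abs_of_pos hs, div_le_iff₀ hs, mul_comm]
    exact hdist i
  have hprod := prod_le_prod_add (Finset.univ : Finset (Fin n))
    (A := fun i => max (1 + (x₀ i + -σ) * (2 * -(1 / (2 * s)) * (x₀ i - y₀ i))) 0)
    (b := fun i => schemeFactor (s ^ 2) z i y₀)
    (e := s * (2 * (K + 1) + 1 + (K + 2) ^ 2 * Real.exp (K + 2))) (R := 2 * (K + 1) + 1)
    (by positivity) (by linarith) (fun i => le_max_right _ _) ?_
    (fun i => ((hz y₀ hy₀).2.1 i).le) ?_ ?_
  · rw [Finset.card_univ, Fintype.card_fin] at hprod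
    have hfin := hb.le_of_factors (posGrid_subset_cube hy₀) hx₀c hs hQ₀ hz₀.le
      (hz.le hh hb.le hy₀) (fun i => by rw [abs_sub_comm]; exact hdist i)
      (hz y₀ hy₀).2.2.le hsup hprod
    have hexp : Real.exp (-(1 / (2 * s)) * sqDist x₀ y₀) ≤ 1 := by
      rw [Real.exp_le_one_iff, neg_mul, neg_nonpos]
      have := sqDist_nonneg x₀ y₀
      positivity
    rw [← div_le_iff₀ hQy]
    calc z y / shiftQuotient (-σ) u y = (shiftQuotient (-σ) u y)⁻¹ * z y := by ring
      _ ≤ _ := hmaxy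
      _ ≤ (shiftQuotient (-σ) u x₀)⁻¹ * 1 * z y₀ := by gcongr
      _ ≤ _ := by rwa [mul_one, inv_mul_eq_div, div_le_iff₀ hQ₀]
  · intro i
    obtain ⟨p, hpe, hp⟩ := hp i
    rw [hpe]
    have e : 2 * -(1 / (2 * s)) * (s * p) = -p := by field_simp
    rw [e]
    refine max_le ?_ (by linarith)
    have h1 : (x₀ i + -σ) * -p ≤ (x₀ i + -σ) * (K + 1) :=
      mul_le_mul_of_nonneg_left ((neg_le_abs p).trans hp) (hx₀σ i).le
    have h2 : (x₀ i + -σ) * (K + 1) ≤ 2 * (K + 1) :=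
      mul_le_mul_of_nonneg_right (by linarith [(hx₀ i).2]) (by linarith)
    linarith
  · exact fun i => (hb.schemeFactor_le hh hz hy₀ i).trans (by linarith)
  · -- Consistency: the scheme sees the gradient of the penalization up to `O(s)`.
    intro i
    obtain ⟨p, hpe, hp⟩ := hp i
    have e : 2 * -(1 / (2 * s)) * (x₀ i - y₀ i) = -p := by rw [hpe]; field_simp
    rw [e]
    have hpp := abs_le.1 hp
    have hE : 0 ≤ (K + 2) ^ 2 * Real.exp (K + 2) := by positivity
    have hE' : s ^ 2 * ((K + 2) ^ 2 * Real.exp (K + 2)) ≤ s * ((K + 2) ^ 2 * Real.exp (K + 2)) :=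
      mul_le_mul_of_nonneg_right hhs hE
    have hy1 := (hy₀.1 i).2
    have hyh := le_apply_of_mem_posGrid hh hy₀ i
    have h8 : (y₀ i - s ^ 2) * (s / 2) ≤ s / 2 := by nlinarith
    have hF : 1 - (y₀ i - s ^ 2) * (p + s / 2) - s ^ 2 * ((K + 2) ^ 2 * Real.exp (K + 2)) ≤
        schemeFactor (s ^ 2) z i y₀ := by
      rcases eq_or_back_mem_posGrid hh hy₀ i with hi | hi
      · rw [schemeFactor_of_eq hh hi, hi, sub_self, zero_mul, sub_zero]
        linarith [mul_nonneg hh.le hE]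
      · have h3 := hmaxG _ hi
        rw [sqDist_back, hpe, mul_add, Real.exp_add, ← mul_assoc, mul_right_comm] at h3
        have h4 := le_of_mul_le_mul_right h3 (Real.exp_pos _)
        set t : ℝ := s ^ 2 * (p + s / 2) with ht
        have e2 : -(1 / (2 * s)) * (2 * s ^ 2 * (s * p) + (s ^ 2) ^ 2) = -t := by
          rw [ht]; field_simp
        rw [e2, Real.exp_neg, ← div_eq_mul_inv, div_le_iff₀ (Real.exp_pos _), mul_comm] at h4
        have h5 : z (back (s ^ 2) i y₀) / z y₀ ≤ Real.exp t := (div_le_iff₀ hz₀).2 h4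
        have hq : |p + s / 2| ≤ K + 2 := by rw [abs_le]; constructor <;> linarith
        have htK : |t| ≤ K + 2 := by
          rw [ht, abs_mul, abs_of_pos hh]
          calc s ^ 2 * |p + s / 2| ≤ 1 * (K + 2) := by
                gcongr; linarith
            _ = K + 2 := one_mul _
        have h6 : Real.exp t ≤ 1 + t + s ^ 2 * (s ^ 2 * ((K + 2) ^ 2 * Real.exp (K + 2))) := by
          refine (exp_le_one_add_add_sq_mul_exp_abs t).trans ?_
          have hsq : (p + s / 2) ^ 2 ≤ (K + 2) ^ 2 := sq_le_sq' (abs_le.1 hq).1 (abs_le.1 hq).2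
          have : t ^ 2 * Real.exp |t| ≤ (s ^ 2) ^ 2 * (K + 2) ^ 2 * Real.exp (K + 2) := by
            rw [ht, mul_pow]; gcongr
          linarith
        have hc : (y₀ i / s ^ 2 - 1) * (-t - s ^ 2 * (s ^ 2 * ((K + 2) ^ 2 * Real.exp (K + 2)))) =
            -((y₀ i - s ^ 2) * (p + s / 2)) -
              (y₀ i - s ^ 2) * (s ^ 2 * ((K + 2) ^ 2 * Real.exp (K + 2))) := by
          rw [ht]; field_simp
        have h7 := mul_le_mul_of_nonneg_left
          (show -t - s ^ 2 * (s ^ 2 * ((K + 2) ^ 2 * Real.exp (K + 2))) ≤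
            1 - z (back (s ^ 2) i y₀) / z y₀ by linarith)
          (schemeFactor_coeff_nonneg hh hy₀ i)
        have h9 : (y₀ i - s ^ 2) * (s ^ 2 * ((K + 2) ^ 2 * Real.exp (K + 2))) ≤
            1 * (s ^ 2 * ((K + 2) ^ 2 * Real.exp (K + 2))) :=
          mul_le_mul_of_nonneg_right (by linarith) (mul_nonneg hh.le hE)
        rw [schemeFactor]
        linarith
    have he0 : 0 ≤ s * (2 * (K + 1) + 1 + (K + 2) ^ 2 * Real.exp (K + 2)) := by positivity
    refine max_le ?_ (add_nonneg ((hz y₀ hy₀).2.1 i).le he0)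
    have e3 : x₀ i = y₀ i + s * p := by linarith
    -- Here too the difference of the two linear factors carries the sign of `-s p²`.
    have h9 : (x₀ i + -σ) * -p = -((y₀ i - s ^ 2) * p) - s * p ^ 2 - (s ^ 2 - σ) * p := by
      rw [e3]; ring
    have h10 : -((s ^ 2 - σ) * p) ≤ (s ^ 2 - σ) * (K + 1) := by
      rw [← mul_neg]
      exact mul_le_mul_of_nonneg_left (by linarith) (by linarith)
    have h11 : (s ^ 2 - σ) * (K + 1) ≤ s * (K + 1) :=
      mul_le_mul_of_nonneg_right (by linarith) (by linarith)
    have h12 : 0 ≤ s * p ^ 2 := by positivity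
    have h13 : 0 ≤ s * K := by positivity
    linarith

/-! ### Convergence rates -/

variable {v : EuclideanSpace ℝ (Fin n) → ℝ}

lemma tendsto_shiftQuotient {y : EuclideanSpace ℝ (Fin n)} (hy : ∀ i, 0 < y i) :
    Tendsto (fun τ => shiftQuotient τ u y) (𝓝 0) (𝓝 (shiftQuotient 0 u y)) := by
  have hc : Continuous fun τ : ℝ => ∏ i, (y i + τ) := by fun_prop
  refine tendsto_const_nhds.div (hc.tendsto 0) ?_
  exact (Finset.prod_pos fun i _ => by simpa using hy i).ne'

/-- The maximal solution of the scheme and the viscosity solution agree up to a relative error of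
order `√h`. -/
lemma relative_error (hn : n ≠ 0) (hb : RhsBounds f K m M) (hu : IsViscositySolution f u)
    (hmono : IsNondecreasing u) (hh : 0 < h) (hz : IsQuotientSolution h f z)
    {y : EuclideanSpace ℝ (Fin n)} (hy : y ∈ posGrid n h) :
    shiftQuotient 0 u y ≤ (1 + rateConst n K m M * √h) * z y ∧
      z y ≤ (1 + rateConst n K m M * √h) * shiftQuotient 0 u y := by
  have hs : 0 < √h := Real.sqrt_pos.2 hh
  have hss : √h ^ 2 = h := Real.sq_sqrt hh.le
  have h1 : h ≤ 1 :=
    (le_apply_of_mem_posGrid hh hy ⟨0, Nat.pos_of_ne_zero hn⟩).trans (hy.1 _).2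
  have hs1 : √h ≤ 1 := Real.sqrt_le_one.2 h1
  have hyi : ∀ i, 0 < y i := fun i => (hy.1 i).1
  have hev : ∀ᶠ σ in 𝓝[>] (0 : ℝ), 0 < σ ∧ σ < h := Ioo_mem_nhdsGT hh
  have ht := tendsto_shiftQuotient (u := u) hyi
  constructor
  · refine le_of_tendsto (ht.mono_left (nhdsWithin_le_nhds (s := Set.Ioi 0))) ?_
    filter_upwards [hev] with σ hσ
    exact shiftQuotient_le_quotientSolution hn hb hu hmono hs hs1 hσ.1 (hss.symm ▸ hσ.2.le)
      (hss.symm ▸ hz) (hss.symm ▸ hy)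
  · have hneg : Tendsto (fun σ : ℝ => shiftQuotient (-σ) u y) (𝓝[>] 0)
        (𝓝 (shiftQuotient 0 u y)) := by
      refine ht.comp ?_
      have : Tendsto (fun σ : ℝ => -σ) (𝓝 0) (𝓝 (-0)) := tendsto_id.neg
      rw [neg_zero] at this
      exact this.mono_left nhdsWithin_le_nhds
    refine ge_of_tendsto (hneg.const_mul _) ?_
    filter_upwards [hev] with σ hσ
    exact quotientSolution_le_shiftQuotient hn hb hu hmono hs hs1 hσ.1 (hss.symm ▸ hσ.2)
      (hss.symm ▸ hz) (hss.symm ▸ hy)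

lemma RhsBounds.rateConst_nonneg (hb : RhsBounds f K m M) : 0 ≤ rateConst n K m M := by
  have hK := hb.K_nonneg
  have hm := hb.m_pos
  have hM : 0 ≤ M := hm.le.trans ((hb.ge 0 fun i => by simp).trans (hb.le 0 fun i => by simp))
  unfold rateConst
  positivity

/-- The error between `n^n v` and `u^n`. -/
lemma abs_sub_pow_le (hn : n ≠ 0) (hb : RhsBounds f K m M) (hu : IsViscositySolution f u)
    (hmono : IsNondecreasing u) (hh : 0 < h) (hv : IsMaximalSchemeSolution h f v)
    {y : EuclideanSpace ℝ (Fin n)} (hy : y ∈ posGrid n h) :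
    |(n : ℝ) ^ n * v y - u y ^ n| ≤
      (n : ℝ) ^ n * rateConst n K m M * (1 + rateConst n K m M) * M * √h := by
  have hz := hv.isQuotientSolution hn hh hb.pos
  obtain ⟨h1, h2⟩ := relative_error hn hb hu hmono hh hz hy
  have hzM : v y / ∏ i, y i ≤ M := hz.le hh hb.le hy
  have hz0 : 0 < v y / ∏ i, y i := (hz y hy).1
  have hP : 0 < ∏ i, y i := Finset.prod_pos fun i _ => (hy.1 i).1
  have hP1 : ∏ i, y i ≤ 1 := Finset.prod_le_one (fun i _ => (hy.1 i).1.le) fun i _ => (hy.1 i).2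
  have hn' : (0 : ℝ) < (n : ℝ) ^ n := by positivity
  have hC := hb.rateConst_nonneg
  set C := rateConst n K m M
  have hs1 : √h ≤ 1 := Real.sqrt_le_one.2
    ((le_apply_of_mem_posGrid hh hy ⟨0, Nat.pos_of_ne_zero hn⟩).trans (hy.1 _).2)
  have hs0 := Real.sqrt_nonneg h
  set Z := shiftQuotient 0 u y with hZ
  set w := v y / ∏ i, y i with hw
  have e : (n : ℝ) ^ n * v y - u y ^ n = (n : ℝ) ^ n * (∏ i, y i) * (w - Z) := by
    rw [hZ, hw, shiftQuotient, div_pow]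
    simp only [add_zero]
    field_simp
  have hM : 0 ≤ M := hz0.le.trans hzM
  have hCs : 0 ≤ C * √h := by positivity
  have hCs1 : C * √h ≤ C := mul_le_of_le_one_right hC hs1
  have hZM : Z ≤ (1 + C) * M := h1.trans (by gcongr)
  have hCM : 0 ≤ C * M := by positivity
  have hdiff : |w - Z| ≤ C * √h * ((1 + C) * M) := by
    rw [abs_le]
    constructor
    · have h3 : C * √h * w ≤ C * √h * ((1 + C) * M) := by gcongr; linarith
      linarith
    · have h3 : C * √h * Z ≤ C * √h * ((1 + C) * M) := by gcongr
      linarith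
  rw [e, abs_mul, abs_of_pos (mul_pos hn' hP)]
  calc (n : ℝ) ^ n * (∏ i, y i) * |w - Z| ≤ (n : ℝ) ^ n * 1 * (C * √h * ((1 + C) * M)) := by gcongr
    _ = _ := by ring

lemma abs_sub_mul_pow_le (hn : n ≠ 0) {a b : ℝ} (ha : 0 ≤ a) (hb : 0 ≤ b) :
    |a - b| * a ^ (n - 1) ≤ |a ^ n - b ^ n| := by
  have hpow : ∀ s : ℝ, s ^ n = s * s ^ (n - 1) := fun s => (mul_pow_sub_one hn s).symm
  rw [hpow a, hpow b]
  rcases le_total a b with hab | hab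
  · have h1 := mul_le_mul_of_nonneg_left (pow_le_pow_left₀ ha hab (n - 1)) hb
    rw [abs_of_nonpos (by linarith)]
    exact le_trans (by linarith) (neg_le_abs _)
  · have h1 := mul_le_mul_of_nonneg_left (pow_le_pow_left₀ hb hab (n - 1)) hb
    rw [abs_of_nonneg (by linarith)]
    exact le_trans (by linarith) (le_abs_self _)

/-- An error bound for `n^n v - u^n` gives one for `n v^(1/n) - u`, since `v ≥ m ∏ y_i`. -/
lemma abs_sub_le_of_abs_sub_pow_le (hn : n ≠ 0) (hb : RhsBounds f K m M)
    (hu : IsViscositySolution f u) (hmono : IsNondecreasing u) (hh : 0 < h)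
    (hv : IsMaximalSchemeSolution h f v) {E δ : ℝ} (hδ : 0 < δ)
    {y : EuclideanSpace ℝ (Fin n)} (hy : y ∈ posGrid n h) (hyδ : ∀ i, δ ≤ y i)
    (hE : |(n : ℝ) ^ n * v y - u y ^ n| ≤ E) :
    |(n : ℝ) * v y ^ (1 / (n : ℝ)) - u y| ≤
      ((n * m ^ (1 / (n : ℝ))) ^ (n - 1))⁻¹ * δ ^ (1 - (n : ℤ)) * E := by
  have hz := hv.isQuotientSolution hn hh hb.pos
  have hP : 0 < ∏ i, y i := Finset.prod_pos fun i _ => (hy.1 i).1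
  have hm := hb.m_pos
  have hvy : m * δ ^ n ≤ v y := by
    have h1 : m ≤ v y / ∏ i, y i := hz.ge hh hb.ge hy
    rw [le_div_iff₀ hP] at h1
    refine le_trans ?_ h1
    have : ∏ _i : Fin n, δ ≤ ∏ i, y i := Finset.prod_le_prod (fun _ _ => hδ.le) fun i _ => hyδ i
    rw [Finset.prod_const, Finset.card_univ, Fintype.card_fin] at this
    gcongr
  have hv0 : 0 ≤ v y := le_trans (by positivity) hvy
  have hn' : (0 : ℝ) < n := by positivity
  set a := (n : ℝ) * v y ^ (1 / (n : ℝ)) with ha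
  have hapow : a ^ n = (n : ℝ) ^ n * v y := by
    rw [ha, mul_pow, one_div, Real.rpow_inv_natCast_pow hv0 hn]
  have hlow : n * m ^ (1 / (n : ℝ)) * δ ≤ a := by
    have h1 : (m * δ ^ n) ^ (1 / (n : ℝ)) ≤ v y ^ (1 / (n : ℝ)) :=
      Real.rpow_le_rpow (by positivity) hvy (by positivity)
    rw [Real.mul_rpow hm.le (by positivity), one_div, Real.pow_rpow_inv_natCast hδ.le hn,
      ← one_div] at h1
    rw [ha, mul_assoc]
    gcongr
  set c := n * m ^ (1 / (n : ℝ)) with hc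
  have hc0 : 0 < c := by positivity
  have h1 := abs_sub_mul_pow_le hn (show 0 ≤ a by positivity)
    (hu.nonneg hn hmono (posGrid_subset_cube hy))
  rw [hapow] at h1
  have h2 : |a - u y| * (c * δ) ^ (n - 1) ≤ E :=
    le_trans (by gcongr) (h1.trans hE)
  have e : δ ^ (1 - (n : ℤ)) = (δ ^ (n - 1))⁻¹ := by
    rw [← zpow_natCast, ← zpow_neg, Nat.cast_sub (Nat.one_le_iff_ne_zero.2 hn)]
    congr 1; push_cast; ring
  rw [e, ← mul_inv, ← mul_pow, inv_mul_eq_div, le_div_iff₀ (by positivity)]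
  exact h2

lemma dist_le_sum_abs (x y : EuclideanSpace ℝ (Fin n)) : dist x y ≤ ∑ i, |x i - y i| := by
  rw [EuclideanSpace.dist_eq, Real.sqrt_le_left (Finset.sum_nonneg fun _ _ => abs_nonneg _)]
  simp only [Real.dist_eq]
  exact Finset.sum_sq_le_sq_sum_of_nonneg fun _ _ => abs_nonneg _

lemma rhsBounds_of_lipschitz {L : ℝ≥0} (hf : LipschitzOnWith L f (cube n))
    (hpos : ∀ x ∈ cube n, 0 < f x) (hm : sInf (f '' cube n) = m) :
    RhsBounds f (L / m) m (m + L * n) := by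
  have h0 : (0 : EuclideanSpace ℝ (Fin n)) ∈ cube n := fun i => by simp
  have hbdd : BddBelow (f '' cube n) := ⟨0, by rintro _ ⟨x, hx, rfl⟩; exact (hpos x hx).le⟩
  have hge : ∀ x ∈ cube n, m ≤ f x := fun x hx => hm ▸ csInf_le hbdd ⟨x, hx, rfl⟩
  have hm0 : 0 < m := by
    obtain ⟨x, hx, hmin⟩ := (isCompact_cube n).exists_isMinOn ⟨0, h0⟩ hf.continuousOn
    rw [← hm]
    refine (hpos x hx).trans_le (le_csInf ⟨_, 0, h0, rfl⟩ ?_)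
    rintro _ ⟨y, hy, rfl⟩
    exact hmin hy
  have hlip : ∀ x ∈ cube n, ∀ y ∈ cube n, f x ≤ f y + L * ∑ i, |x i - y i| := by
    intro x hx y hy
    have h1 := hf.dist_le_mul x hx y hy
    rw [Real.dist_eq] at h1
    have h2 : (L : ℝ) * dist x y ≤ L * ∑ i, |x i - y i| := by
      gcongr; exact dist_le_sum_abs x y
    linarith [le_abs_self (f x - f y)]
  refine ⟨by positivity, hm0, hge, fun x hx => ?_, fun x hx y hy => ?_⟩
  · have h1 : f x - L * n ≤ m := by
      rw [← hm]
      refine le_csInf ⟨_, 0, h0, rfl⟩ ?_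
      rintro _ ⟨y, hy, rfl⟩
      have h2 : ∑ i, |x i - y i| ≤ n := by
        refine (Finset.sum_le_card_nsmul _ _ 1 fun i _ => ?_).trans_eq (by simp)
        rw [abs_le]
        constructor <;> linarith [(hx i).1, (hx i).2, (hy i).1, (hy i).2]
      have h3 : (L : ℝ) * ∑ i, |x i - y i| ≤ L * n := by gcongr
      linarith [hlip x hx y hy]
    linarith
  · have h1 : (L : ℝ) * ∑ i, |x i - y i| ≤ L / m * (∑ i, |x i - y i|) * f y := by
      have hS : 0 ≤ ∑ i, |x i - y i| := Finset.sum_nonneg fun _ _ => abs_nonneg _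
      have h2 := mul_le_mul_of_nonneg_left (hge y hy)
        (show 0 ≤ (L : ℝ) / m * ∑ i, |x i - y i| by positivity)
      refine le_trans (le_of_eq ?_) h2
      field_simp
    linarith [hlip x hx y hy]

end HJ

theorem theorem1p1 (n : ℕ) (hn : 1 ≤ n) (L : ℝ≥0) (m : ℝ) :
    ∃ C : ℝ, 0 < C ∧
      ∀ f : EuclideanSpace ℝ (Fin n) → ℝ,
        LipschitzOnWith L f (HJ.cube n) →
        (∀ x ∈ HJ.cube n, 0 < f x) →
        sInf (f '' HJ.cube n) = m →
        ∀ u : EuclideanSpace ℝ (Fin n) → ℝ,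
          HJ.IsViscositySolution f u → HJ.IsNondecreasing u →
          ∀ h : ℝ, 0 < h →
            ∀ v : EuclideanSpace ℝ (Fin n) → ℝ, HJ.IsMaximalSchemeSolution h f v →
              (∀ x ∈ HJ.cube n ∩ HJ.grid n h,
                |(n : ℝ) ^ n * v x - u x ^ n| ≤ C * √h) ∧
              (∀ δ : ℝ, 0 < δ → ∀ x ∈ HJ.subcube n δ ∩ HJ.grid n h,
                |(n : ℝ) * v x ^ (1 / (n : ℝ)) - u x| ≤ C * δ ^ (1 - (n : ℤ)) * √h) := by
  have hn0 : n ≠ 0 := Nat.one_le_iff_ne_zero.1 hn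
  set R := HJ.rateConst n (L / m) m (m + L * n)
  set C₁ := (n : ℝ) ^ n * R * (1 + R) * (m + L * n)
  set C₂ := ((n * m ^ (1 / (n : ℝ))) ^ (n - 1))⁻¹ * C₁
  refine ⟨1 + |C₁| + |C₂|, by positivity, ?_⟩
  intro f hf hpos hm u hu hmono h hh v hv
  have hb := HJ.rhsBounds_of_lipschitz hf hpos hm
  have hC₁ : C₁ ≤ 1 + |C₁| + |C₂| := by linarith [le_abs_self C₁, abs_nonneg C₂]
  have hC₂ : C₂ ≤ 1 + |C₁| + |C₂| := by linarith [le_abs_self C₂, abs_nonneg C₁]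
  constructor
  · rintro x ⟨hx, hxg⟩
    by_cases hx' : x ∈ HJ.halfOpenCube n
    · refine (HJ.abs_sub_pow_le hn0 hb hu hmono hh hv ⟨hx', hxg⟩).trans ?_
      exact mul_le_mul_of_nonneg_right hC₁ (Real.sqrt_nonneg h)
    · rw [hv.1 x ⟨HJ.mem_Gam_of_notMem_halfOpenCube hx hx', hxg⟩, hu.eq_zero hx hx', mul_zero,
        zero_pow hn0, sub_zero, abs_zero]
      positivity
  · rintro δ hδ x ⟨hx, hxg⟩
    have hx' : x ∈ HJ.posGrid n h := ⟨fun i => ⟨hδ.trans_le (hx i).1, (hx i).2⟩, hxg⟩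
    refine (HJ.abs_sub_le_of_abs_sub_pow_le hn0 hb hu hmono hh hv hδ hx' (fun i => (hx i).1)
      (HJ.abs_sub_pow_le hn0 hb hu hmono hh hv hx')).trans ?_
    have h1 : C₂ * (δ ^ (1 - (n : ℤ)) * √h) ≤
        (1 + |C₁| + |C₂|) * (δ ^ (1 - (n : ℤ)) * √h) :=
      mul_le_mul_of_nonneg_right hC₂ (by positivity)
    calc _ = C₂ * (δ ^ (1 - (n : ℤ)) * √h) := by ring
      _ ≤ _ := h1
      _ = _ := by ring
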